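/- **Setting.** Let $d\ge 2$, $p\ge 0$, and let $\mathcal T_h$ be a finite conforming simplicial mesh in $\mathbb R^d$ (closed $d$-simplices meeting in common faces), $\overline\Omega=\bigcup_{T\in\mathcal T_h}T$ and $\Omega$ the interior of $\overline\Omega$. Let $\mathcal F_h$ be the set of facets and $h_F=\operatorname{diam}F$. Write $h_K$ for the diameter of an element $K$ and $\rho_K$ for the diameter of the largest ball contained in $K$. Let $\rho,c_s:\overline\Omega\to\mathbb R$ be continuous with $0<\underline\rho\le\rho\le\overline\rho$ and $0<\underline{c_s}\le c_s\le\overline{c_s}$, and let $\mathbf b:\overline\Omega\to\mathbb R^d$ satisfy $\mathbf b\cdot\mathbf n=0$ on $\partial\Omega$ and $\|\mathbf b\|_\infty:=\|\mathbf b\|_{L^\infty(\Omega)}>0$. Put $\partial_{\mathbf b}\mathbf u=(\mathbf b\cdot\nabla)\mathbf u$ and $$\mathbb X_h=\{\mathbf u\in L^2(\Omega,\mathbb R^d):\ \mathbf u|_T\in\mathbb P^p(T,\mathbb R^d)\ \ \forall T\in\mathcal T_h\}.$$ On an interior facet, with $\pm$ denoting the traces from the two adjacent elements and $\mathbf n^\pm$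 their outward unit normals, let $$\{\!\{w\}\!\}=\tfrac12(w^++w^-),\quad [\![\mathbf u]\!]_{\mathbf b}=\mathbf u^+(\mathbf b\cdot\mathbf n^+)+\mathbf u^-(\mathbf b\cdot\mathbf n^-),\quad [\![\mathbf u]\!]_{\mathbf n}=\mathbf u^+\cdot\mathbf n^++\mathbf u^-\cdot\mathbf n^-;$$ on a boundary facet let $\{\!\{w\}\!\}=w$, $[\![\mathbf u]\!]_{\mathbf b}=\mathbf u\,(\mathbf b\cdot\mathbf n)=0$, $[\![\mathbf u]\!]_{\mathbf n}=\mathbf u\cdot\mathbf n$. For penalty parameters $\lambda_{\mathbf b},\lambda_{\mathbf n}>0$ and $\mathbf u,\mathbf v\in\mathbb X_h$ define $$\begin{aligned}a_h(\mathbf u,\mathbf v)={}&\sum_{T\in\mathcal T_h}\int_T\rho\big[\partial_{\mathbf b}\mathbf u\cdot\partial_{\mathbf b}\mathbf v+\|\mathbf b\|_\infty^2\,\mathbf u\cdot\mathbf v\big]dx\\&+\sum_{F\in\mathcal F_h}\int_F\rho\Big[\tfrac{\lambda_{\mathbf b}}{h_F}[\![\mathbf u]\!]_{\mathbf b}\cdot[\![\mathbf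 v]\!]_{\mathbf b}-\{\!\{\partial_{\mathbf b}\mathbf u\}\!\}\cdot[\![\mathbf v]\!]_{\mathbf b}-\{\!\{\partial_{\mathbf b}\mathbf v\}\!\}\cdot[\![\mathbf u]\!]_{\mathbf b}\Big]ds,\\ b_h(\mathbf u,\mathbf v)={}&\sum_{T\in\mathcal T_h}\int_T\rho c_s^2\operatorname{div}\mathbf u\,\operatorname{div}\mathbf v\,dx\\&+\sum_{F\in\mathcal F_h}\int_F\rho c_s^2\Big[\tfrac{\lambda_{\mathbf n}}{h_F}[\![\mathbf u]\!]_{\mathbf n}[\![\mathbf v]\!]_{\mathbf n}-\{\!\{\operatorname{div}\mathbf u\}\!\}[\![\mathbf v]\!]_{\mathbf n}-\{\!\{\operatorname{div}\mathbf v\}\!\}[\![\mathbf u]\!]_{\mathbf n}\Big]ds.\end{aligned}$$ **Theorem.** Assume that the mesh is shape regular, $h_K/\rho_K\le c_{\mathcal T}$ for all $K\in\mathcal T_h$, that $\mathbf b$ is Lipschitz with Lipschitz constant $L$, and that $\overline\rho/\underline\rho\le R_\rho$, $\overline{c_s}/\underline{c_s}\le R_{c_s}$. Then there are $c_1>0$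 and $\lambda_{\mathbf b}^0>0$ depending only on $d,p,c_{\mathcal T},R_\rho,L,\|\mathbf b\|_\infty$, and $c_2>0$ and $\lambda_{\mathbf n}^0>0$ depending only on $d,p,c_{\mathcal T},R_\rho,R_{c_s}$ (in particular, none of them depends on the mesh otherwise), such that for all $\lambda_{\mathbf b}\ge\lambda_{\mathbf b}^0$, $\lambda_{\mathbf n}\ge\lambda_{\mathbf n}^0$ and all $\mathbf u_h\in\mathbb X_h$ $$a_h(\mathbf u_h,\mathbf u_h)\ge c_1\Big(\sum_T\|\sqrt\rho\,\partial_{\mathbf b}\mathbf u_h\|_{L^2(T)}^2+\sum_T\|\sqrt\rho\,\mathbf u_h\|_{L^2(T)}^2+\sum_{F}\big\|h_F^{-1/2}\sqrt\rho\,[\![\mathbf u_h]\!]_{\mathbf b}\big\|_{L^2(F)}^2\Big),$$ $$b_h(\mathbf u_h,\mathbf u_h)\ge c_2\Big(\sum_T\|c_s\sqrt\rho\operatorname{div}\mathbf u_h\|_{L^2(T)}^2+\sum_{F}\big\|h_F^{-1/2}c_s\sqrt\rho\,[\![\mathbf u_h]\!]_{\mathbf n}\big\|_{L^2(F)}^2\Big).$$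 Moreover, for such $\lambda_{\mathbf b},\lambda_{\mathbf n}$, $\mathbf u_h\mapsto\big(a_h(\mathbf u_h,\mathbf u_h)+b_h(\mathbf u_h,\mathbf u_h)\big)^{1/2}$ is a norm on $\mathbb X_h$. -/

import Mathlib

open MeasureTheory
open scoped NNReal ENNReal InnerProductSpace

noncomputable section

namespace GalbrunDG

/-- The Euclidean space `ℝᵈ`. -/
abbrev Vec (d : ℕ) := EuclideanSpace ℝ (Fin d)

/-! ### Simplicial meshes -/

/-- A (conforming) simplicial mesh in `ℝᵈ`: a finite simplicial complex, all of whose faces are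
faces of `d`-dimensional simplices. Simplices are represented by their finite vertex sets; the
closed simplex with vertex set `T` is `convexHull ℝ T`. -/
structure SimplicialMesh (d : ℕ) extends Geometry.SimplicialComplex ℝ (Vec d) where
  finite_faces : faces.Finite
  pure : ∀ s ∈ faces, ∃ T ∈ faces, s ⊆ T ∧ T.card = d + 1

/-- The diameter of the largest ball contained in `K`. -/
def inballDiam {d : ℕ} (K : Set (Vec d)) : ℝ :=
  2 * sSup {r : ℝ | ∃ x, Metric.closedBall x r ⊆ K}

/-- The unit normal on the facet `F` of the simplex `T`, pointing out of `T`: the normalized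
component orthogonal to `F` of the vector from the vertex of `T` opposite to `F` to the centroid
of `F`. -/
def outwardNormal {d : ℕ} (T F : Finset (Vec d)) : Vec d :=
  let a := (vectorSpan ℝ (F : Set (Vec d)))ᗮ.starProjection
    ((F.card : ℝ)⁻¹ • ∑ x ∈ F, x - ∑ v ∈ T \ F, v)
  ‖a‖⁻¹ • a

namespace SimplicialMesh

variable {d : ℕ} (𝒯 : SimplicialMesh d)

/-- The elements of the mesh: its `d`-dimensional simplices. -/
def cells : Finset (Finset (Vec d)) :=
  𝒯.finite_faces.toFinset.filter (fun T => T.card = d + 1)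

/-- The facets of the mesh: its `(d-1)`-dimensional simplices. -/
def facets : Finset (Finset (Vec d)) :=
  𝒯.finite_faces.toFinset.filter (fun F => F.card = d)

/-- The elements adjacent to a facet: two for an interior facet, one for a boundary facet. -/
def adj (F : Finset (Vec d)) : Finset 𝒯.cells :=
  open Classical in Finset.univ.filter (fun T => F ⊆ T.1)

/-- The union of the closed elements of the mesh, i.e. the closure of the meshed domain. -/
def closedDomain : Set (Vec d) := ⋃ T ∈ 𝒯.cells, convexHull ℝ (T : Set (Vec d))

/-- The (open) domain that is subdivided by the mesh. -/
def domain : Set (Vec d) := interior 𝒯.closedDomain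

/-- Shape regularity `h_K / ρ_K ≤ c` of all elements, where `h_K` is the diameter of `K` and `ρ_K`
the diameter of the largest ball in `K`. -/
def ShapeRegular (c : ℝ) : Prop :=
  ∀ T ∈ 𝒯.cells, Metric.diam (convexHull ℝ (T : Set (Vec d))) /
    inballDiam (convexHull ℝ (T : Set (Vec d))) ≤ c

/-- Tangential flow: `b · n = 0` on the boundary of the meshed domain, i.e. on all facets that
belong to one element only. -/
def TangentialOnBoundary (b : Vec d → Vec d) : Prop :=
  ∀ F ∈ 𝒯.facets, (𝒯.adj F).card = 1 → ∀ T ∈ 𝒯.adj F,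
    ∀ x ∈ convexHull ℝ (F : Set (Vec d)), ⟪b x, outwardNormal T.1 F⟫_ℝ = 0

/-- The integral `∫_T f dx` over an element. -/
def cellInt (T : 𝒯.cells) (f : Vec d → ℝ) : ℝ :=
  ∫ x in convexHull ℝ (T.1 : Set (Vec d)), f x

end SimplicialMesh

/-- The integral `∫_F f ds` over a facet with respect to the `(d-1)`-dimensional surface measure. -/
def facetInt {d : ℕ} (F : Finset (Vec d)) (f : Vec d → ℝ) : ℝ :=
  ∫ x in convexHull ℝ (F : Set (Vec d)), f x ∂μHE[d - 1]

/-- The diameter `h_F` of a facet. -/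
def facetDiam {d : ℕ} (F : Finset (Vec d)) : ℝ := Metric.diam (convexHull ℝ (F : Set (Vec d)))

/-- The norm `‖b‖_∞` in `L^∞(Ω, ℝᵈ)`. -/
def supNorm {d : ℕ} (b : Vec d → Vec d) (Ω : Set (Vec d)) : ℝ :=
  (eLpNorm b ∞ (volume.restrict Ω)).toReal

/-! ### The discrete space -/

/-- `v : ℝᵈ → ℝᵈ` is a vector polynomial of (total) degree at most `p`. -/
def IsVecPoly {d : ℕ} (p : ℕ) (v : Vec d → Vec d) : Prop :=
  ∀ i, ∃ q : MvPolynomial (Fin d) ℝ, q.totalDegree ≤ p ∧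
    ∀ x : Vec d, v x i = MvPolynomial.eval (fun j => x j) q

/-- The discontinuous space `X_h` of vector fields on the mesh which are polynomials of degree at
most `p` on each element, without any continuity across facets. An element of `X_h` is given by its
polynomial pieces `u T`, one for each mesh element `T` (the restriction of a polynomial to an
element determines the polynomial). -/
def dgSpace {d : ℕ} (𝒯 : SimplicialMesh d) (p : ℕ) :
    Submodule ℝ (𝒯.cells → Vec d → Vec d) where
  carrier := {u | ∀ T, IsVecPoly p (u T)}
  zero_mem' := fun T i => ⟨0, by simp, by simp⟩
  add_mem' := by
    intro u v hu hv T i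
    obtain ⟨q, hq, hq'⟩ := hu T i
    obtain ⟨r, hr, hr'⟩ := hv T i
    exact ⟨q + r, (MvPolynomial.totalDegree_add q r).trans (max_le hq hr),
      fun x => by simp [hq', hr']⟩
  smul_mem' := by
    intro c u hu T i
    obtain ⟨q, hq, hq'⟩ := hu T i
    exact ⟨c • q, (MvPolynomial.totalDegree_smul_le c q).trans hq,
      fun x => by simp [hq', MvPolynomial.smul_eval]⟩

/-- The streamline derivative `∂_b v = (b · ∇) v`. -/
def conv {d : ℕ} (b v : Vec d → Vec d) (x : Vec d) : Vec d := fderiv ℝ v x (b x)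

/-- The divergence of a vector field. -/
def divg {d : ℕ} (v : Vec d → Vec d) (x : Vec d) : ℝ :=
  ∑ i, fderiv ℝ v x (EuclideanSpace.single i 1) i

section Forms

variable {d : ℕ} (𝒯 : SimplicialMesh d)

/-- The average on a facet of a piecewise defined function: `(w⁺ + w⁻) / 2` on an interior facet,
`w` on a boundary facet. -/
def avg {V : Type*} [AddCommGroup V] [Module ℝ V] (F : Finset (Vec d))
    (w : 𝒯.cells → Vec d → V) (x : Vec d) : V :=
  ((𝒯.adj F).card : ℝ)⁻¹ • ∑ T ∈ 𝒯.adj F, w T x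

/-- The normal jump on a facet: `u⁺ · n⁺ + u⁻ · n⁻` on an interior facet, `u · n` on a boundary
facet. -/
def njump (F : Finset (Vec d)) (u : 𝒯.cells → Vec d → Vec d) (x : Vec d) : ℝ :=
  ∑ T ∈ 𝒯.adj F, ⟪u T x, outwardNormal T.1 F⟫_ℝ

/-- The jump weighted with the normal velocity: `u⁺ (b · n⁺) + u⁻ (b · n⁻)` on an interior facet,
`u (b · n)` on a boundary facet (which is zero if `b · n = 0` on the boundary). -/
def bjump (b : Vec d → Vec d) (F : Finset (Vec d)) (u : 𝒯.cells → Vec d → Vec d)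
    (x : Vec d) : Vec d :=
  ∑ T ∈ 𝒯.adj F, ⟪b x, outwardNormal T.1 F⟫_ℝ • u T x

/-- The form `a_h`, with density `ρ`, flow `b` and penalty parameter `lam`. -/
def aForm (ρ : Vec d → ℝ) (b : Vec d → Vec d) (lam : ℝ) (u v : 𝒯.cells → Vec d → Vec d) : ℝ :=
  (∑ T : 𝒯.cells, 𝒯.cellInt T fun x =>
      ρ x * (⟪conv b (u T) x, conv b (v T) x⟫_ℝ + supNorm b 𝒯.domain ^ 2 * ⟪u T x, v T x⟫_ℝ))
    + (∑ F ∈ 𝒯.facets, facetInt F fun x =>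
        ρ x * (lam / facetDiam F) * ⟪bjump 𝒯 b F u x, bjump 𝒯 b F v x⟫_ℝ)
    - (∑ F ∈ 𝒯.facets, facetInt F fun x =>
        ρ x * ⟪avg 𝒯 F (fun T => conv b (u T)) x, bjump 𝒯 b F v x⟫_ℝ)
    - (∑ F ∈ 𝒯.facets, facetInt F fun x =>
        ρ x * ⟪avg 𝒯 F (fun T => conv b (v T)) x, bjump 𝒯 b F u x⟫_ℝ)

/-- The form `b_h`, with density `ρ`, sound speed `cs` and penalty parameter `lam`. -/
def bForm (ρ cs : Vec d → ℝ) (lam : ℝ) (u v : 𝒯.cells → Vec d → Vec d) : ℝ :=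
  (∑ T : 𝒯.cells, 𝒯.cellInt T fun x => ρ x * cs x ^ 2 * (divg (u T) x * divg (v T) x))
    + (∑ F ∈ 𝒯.facets, facetInt F fun x =>
        ρ x * cs x ^ 2 * (lam / facetDiam F) * (njump 𝒯 F u x * njump 𝒯 F v x))
    - (∑ F ∈ 𝒯.facets, facetInt F fun x =>
        ρ x * cs x ^ 2 * (avg 𝒯 F (fun T => divg (u T)) x * njump 𝒯 F v x))
    - (∑ F ∈ 𝒯.facets, facetInt F fun x =>
        ρ x * cs x ^ 2 * (avg 𝒯 F (fun T => divg (v T)) x * njump 𝒯 F u x))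

/-- `‖√ρ ∂_b u‖²_𝒯`: the weighted broken norm of the streamline derivative, squared. -/
def convNormSq (ρ : Vec d → ℝ) (b : Vec d → Vec d) (u : 𝒯.cells → Vec d → Vec d) : ℝ :=
  ∑ T : 𝒯.cells, 𝒯.cellInt T fun x => ‖√(ρ x) • conv b (u T) x‖ ^ 2

/-- `‖√ρ u‖²_𝒯`: the weighted `L²` norm, squared. -/
def l2NormSq (ρ : Vec d → ℝ) (u : 𝒯.cells → Vec d → Vec d) : ℝ :=
  ∑ T : 𝒯.cells, 𝒯.cellInt T fun x => ‖√(ρ x) • u T x‖ ^ 2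

/-- `‖√ρ [u]_b‖²` in the facet norm with weight `h_F^{-1/2}`. -/
def bjumpNormSq (ρ : Vec d → ℝ) (b : Vec d → Vec d) (u : 𝒯.cells → Vec d → Vec d) : ℝ :=
  ∑ F ∈ 𝒯.facets, facetInt F fun x => (facetDiam F)⁻¹ * ‖√(ρ x) • bjump 𝒯 b F u x‖ ^ 2

/-- `‖c_s √ρ div u‖²_𝒯`: the weighted broken norm of the divergence, squared. -/
def divNormSq (ρ cs : Vec d → ℝ) (u : 𝒯.cells → Vec d → Vec d) : ℝ :=
  ∑ T : 𝒯.cells, 𝒯.cellInt T fun x => (cs x * √(ρ x) * divg (u T) x) ^ 2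

/-- `‖c_s √ρ [u]_n‖²` in the facet norm with weight `h_F^{-1/2}`. -/
def njumpNormSq (ρ cs : Vec d → ℝ) (u : 𝒯.cells → Vec d → Vec d) : ℝ :=
  ∑ F ∈ 𝒯.facets, facetInt F fun x => (facetDiam F)⁻¹ * (cs x * √(ρ x) * njump 𝒯 F u x) ^ 2

end Forms

end GalbrunDG

end

noncomputable section

namespace GalbrunDG

/-! ### Polynomial vector fields -/

variable {d p : ℕ}

/-! This is the coercivity argument for symmetric interior penalty methods. On the diagonal the two
consistency terms coincide, and Young's inequality splits them into `ε h_F ‖average‖²` and `ε⁻¹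
h_F⁻¹ ‖jump‖²`. The jump part is absorbed by a large penalty, the average part by the volume terms
through a discrete trace inequality.

The trace inequality comes from finite dimensionality. On the unit ball, the `L²` norm of a
polynomial of degree at most `p` controls its values and gradient on any larger concentric ball, and
this is rescaled to arbitrary balls (`exists_sq_le_integral_ball`). By shape regularity each element
lies between concentric balls of radii `r` and `κ r` (`exists_ball_subset_cell`), and a facet has
measure at most `C h_F ^ (d - 1)` (`exists_facetMeasure_le`). Together these give `exists_trace_le`
without a reference element.

For the divergence this suffices, since `div u` is a polynomial. The streamline derivative is not
one, because `b` is only Lipschitz. So `b` is frozen at the ball's center (`exists_conv_sq_le`). The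
error is at most `L κ r |∇v|`, and the inverse inequality turns `r |∇v|` into `|v|`, leaving a
multiple of `L² ‖v‖²` independent of the mesh size. The term `‖b‖_∞² ‖u‖²` in `a_h` absorbs it if
`ε` is of order `1 / (1 + L² / ‖b‖_∞²)`.

The norm statement follows from Cauchy–Schwarz for a positive semidefinite symmetric form, with
definiteness from the `L²` part of the lower bound. -/

theorem totalDegree_pderiv_le {σ : Type*} (i : σ) (q : MvPolynomial σ ℝ) :
    (MvPolynomial.pderiv i q).totalDegree ≤ q.totalDegree := by
  conv_lhs => rw [q.as_sum, map_sum]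
  refine MvPolynomial.totalDegree_finsetSum_le fun m hm => ?_
  rw [MvPolynomial.pderiv_monomial]
  refine (MvPolynomial.totalDegree_monomial_le _ _).trans (le_trans ?_ (MvPolynomial.le_totalDegree hm))
  exact Finsupp.degree_mono (R := ℕ) (tsub_le_self : m - Finsupp.single i 1 ≤ m)

theorem totalDegree_aeval_le {σ : Type*} (g : σ → MvPolynomial σ ℝ)
    (hg : ∀ i, (g i).totalDegree ≤ 1) (q : MvPolynomial σ ℝ) :
    (MvPolynomial.aeval g q).totalDegree ≤ q.totalDegree := by
  conv_lhs => rw [q.as_sum, map_sum]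
  refine MvPolynomial.totalDegree_finsetSum_le fun m hm => ?_
  refine le_trans ?_ (MvPolynomial.le_totalDegree hm)
  rw [MvPolynomial.aeval_monomial]
  refine (MvPolynomial.totalDegree_mul _ _).trans ?_
  rw [MvPolynomial.algebraMap_eq, MvPolynomial.totalDegree_C, zero_add]
  refine (MvPolynomial.totalDegree_finsetProd _ _).trans ?_
  refine Finset.sum_le_sum fun i _ => ?_
  exact (MvPolynomial.totalDegree_pow _ _).trans (by simpa using Nat.mul_le_mul_left (m i) (hg i))

theorem hasFDerivAt_eval (q : MvPolynomial (Fin d) ℝ) (x : Vec d) :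
    HasFDerivAt (fun y : Vec d => MvPolynomial.eval (fun j => y j) q)
      (∑ i, MvPolynomial.eval (fun j => x j) (MvPolynomial.pderiv i q) •
        (EuclideanSpace.proj i : Vec d →L[ℝ] ℝ)) x := by
  induction q using MvPolynomial.induction_on with
  | C a => simpa using hasFDerivAt_const a x
  | add f g hf hg =>
    simp only [map_add, add_smul, Finset.sum_add_distrib]
    exact hf.add hg
  | mul_X f k hf =>
    have h := hf.mul (EuclideanSpace.proj k : Vec d →L[ℝ] ℝ).hasFDerivAt
    simp only [map_mul, MvPolynomial.eval_X]
    refine h.congr_fderiv ?_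
    ext w
    simp [MvPolynomial.pderiv_X, Pi.single_apply, add_mul, Finset.sum_add_distrib, Finset.mul_sum, apply_ite,
      Finset.sum_ite_eq]
    exact Finset.sum_congr rfl fun i _ => by ring

theorem IsVecPoly.contDiff {v : Vec d → Vec d} (hv : IsVecPoly p v) : ContDiff ℝ 1 v := by
  rw [contDiff_euclidean]
  intro i
  obtain ⟨q, -, hq⟩ := hv i
  simp only [hq]
  have h : AnalyticOnNhd ℝ (fun x : Vec d => MvPolynomial.aeval (fun j => x j) q) Set.univ :=
    AnalyticOnNhd.aeval_mvPolynomial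
      (fun j => (EuclideanSpace.proj j : Vec d →L[ℝ] ℝ).analyticOnNhd _) q
  simpa [MvPolynomial.aeval_eq_eval, contDiffOn_univ] using h.contDiffOn (n := 1) uniqueDiffOn_univ

theorem IsVecPoly.continuous {v : Vec d → Vec d} (hv : IsVecPoly p v) : Continuous v :=
  hv.contDiff.continuous

theorem IsVecPoly.differentiable {v : Vec d → Vec d} (hv : IsVecPoly p v) : Differentiable ℝ v :=
  hv.contDiff.differentiable one_ne_zero

theorem IsVecPoly.continuous_fderiv {v : Vec d → Vec d} (hv : IsVecPoly p v) :
    Continuous (fderiv ℝ v) :=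
  hv.contDiff.continuous_fderiv one_ne_zero

/-- Identity principle for analytic functions. It makes the `L²` norm on a ball definite on
polynomials. -/
theorem IsVecPoly.eq_zero_of_eventuallyEq {v : Vec d → Vec d} (hv : IsVecPoly p v) {x : Vec d}
    (h : v =ᶠ[nhds x] 0) : v = 0 := by
  ext y i
  obtain ⟨q, -, hq⟩ := hv i
  have ha : AnalyticOnNhd ℝ (fun x : Vec d => MvPolynomial.aeval (fun j => x j) q) Set.univ :=
    AnalyticOnNhd.aeval_mvPolynomial
      (fun j => (EuclideanSpace.proj j : Vec d →L[ℝ] ℝ).analyticOnNhd _) q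
  have h0 := ha.eq_of_eventuallyEq (g := 0) (fun _ _ => analyticAt_const) (z₀ := x)
    (h.mono fun y hy => by
      have := hq y
      rw [hy] at this
      simpa [MvPolynomial.aeval_eq_eval] using this.symm)
  simpa [MvPolynomial.aeval_eq_eval, hq] using congrFun h0 y

theorem IsVecPoly.comp_affine {v : Vec d → Vec d} (hv : IsVecPoly p v) (x₀ : Vec d) (r : ℝ) :
    IsVecPoly p (fun x => v (x₀ + r • x)) := by
  intro i
  obtain ⟨q, hq, hq'⟩ := hv i
  refine ⟨MvPolynomial.aeval (fun j => MvPolynomial.C (x₀ j) + MvPolynomial.C r * MvPolynomial.X j)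
    q, (totalDegree_aeval_le _ (fun j => ?_) q).trans hq, fun x => ?_⟩
  · refine (MvPolynomial.totalDegree_add _ _).trans (max_le (by simp) ?_)
    exact (MvPolynomial.totalDegree_mul _ _).trans (by simp)
  · rw [hq', ← MvPolynomial.aeval_eq_eval, ← MvPolynomial.aeval_eq_eval, MvPolynomial.comp_aeval_apply]
    simp

/-- The direction `w` must be constant; this is why the flow field has to be frozen before
polynomial estimates apply to the streamline derivative. -/
theorem IsVecPoly.fderiv_apply {v : Vec d → Vec d} (hv : IsVecPoly p v) (w : Vec d) :
    IsVecPoly p (fun x => fderiv ℝ v x w) := by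
  intro i
  obtain ⟨q, hq, hq'⟩ := hv i
  refine ⟨∑ j, MvPolynomial.C (w j) * MvPolynomial.pderiv j q,
    MvPolynomial.totalDegree_finsetSum_le fun j _ => (MvPolynomial.totalDegree_mul _ _).trans
      (by simpa using (totalDegree_pderiv_le j q).trans hq), fun x => ?_⟩
  have h1 : HasFDerivAt (fun y => v y i)
      ((EuclideanSpace.proj i : Vec d →L[ℝ] ℝ).comp (fderiv ℝ v x)) x :=
    (EuclideanSpace.proj i : Vec d →L[ℝ] ℝ).hasFDerivAt.comp x (hv.differentiable x).hasFDerivAt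
  simp only [hq'] at h1
  have h2 := DFunLike.congr_fun (h1.unique (hasFDerivAt_eval q x)) w
  simp at h2
  simp [h2, mul_comm]

/-- Placing the scalar divergence in one coordinate lets the estimates for vector polynomials be
reused for it, with the same norm. -/
theorem IsVecPoly.single_divg {v : Vec d → Vec d} (hv : IsVecPoly p v) (k : Fin d) :
    IsVecPoly p (fun x => EuclideanSpace.single k (divg v x)) := by
  intro i
  by_cases hik : i = k
  · choose q hq hq' using fun j : Fin d => hv.fderiv_apply (EuclideanSpace.single j 1) j
    refine ⟨∑ j, q j, MvPolynomial.totalDegree_finsetSum_le fun j _ => hq j, fun x => ?_⟩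
    simp [hik, divg, hq']
  · exact ⟨0, by simp, fun x => by simp [hik]⟩

/-! ### Inverse inequalities on balls -/

/-- On the finite-dimensional range of `S` the linear map `G ∘ S⁻¹` is automatically bounded. This
is the only source of the constants in the inverse inequalities. -/
theorem exists_norm_le_mul_norm_of_injective {W H E : Type*} [AddCommGroup W] [Module ℝ W]
    [FiniteDimensional ℝ W] [NormedAddCommGroup H] [NormedSpace ℝ H] [NormedAddCommGroup E]
    [NormedSpace ℝ E] (S : W →ₗ[ℝ] H) (hS : Function.Injective S) (G : W →ₗ[ℝ] E) :
    ∃ C : ℝ, 0 ≤ C ∧ ∀ w, ‖G w‖ ≤ C * ‖S w‖ := by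
  let e := LinearEquiv.ofInjective S hS
  let T := LinearMap.toContinuousLinearMap (G ∘ₗ e.symm.toLinearMap)
  refine ⟨‖T‖, T.opNorm_nonneg, fun w => ?_⟩
  have h := T.le_opNorm (e w)
  have h1 : T (e w) = G w := by simp [T]
  rw [h1] at h
  exact h

/-- The space of vector polynomials of degree at most `p`. -/
def vecPolySpace (d p : ℕ) : Submodule ℝ (Vec d → Vec d) where
  carrier := {v | IsVecPoly p v}
  zero_mem' := fun i => ⟨0, by simp, by simp⟩
  add_mem' := by
    intro u v hu hv i
    obtain ⟨q, hq, hq'⟩ := hu i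
    obtain ⟨r, hr, hr'⟩ := hv i
    exact ⟨q + r, (MvPolynomial.totalDegree_add q r).trans (max_le hq hr),
      fun x => by simp [hq', hr']⟩
  smul_mem' := by
    intro c u hu i
    obtain ⟨q, hq, hq'⟩ := hu i
    exact ⟨c • q, (MvPolynomial.totalDegree_smul_le c q).trans hq,
      fun x => by simp [hq', MvPolynomial.smul_eval]⟩

instance finiteDimensional_vecPolySpace : FiniteDimensional ℝ (vecPolySpace d p) := by
  let Φ : (Fin d → MvPolynomial.restrictTotalDegree (Fin d) ℝ p) →ₗ[ℝ] (Vec d → Vec d) :=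
    { toFun := fun q x => WithLp.toLp 2 fun i => MvPolynomial.eval (fun j => x j) (q i).1
      map_add' := fun q r => by ext x i; simp
      map_smul' := fun c q => by ext x i; simp [MvPolynomial.smul_eval] }
  refine Submodule.finiteDimensional_of_le (S₂ := LinearMap.range Φ) fun v hv => ?_
  choose q hq hq' using hv
  exact ⟨fun i => ⟨q i, (MvPolynomial.mem_restrictTotalDegree _ _ _).2 (hq i)⟩, by
    ext x i; simp [Φ, hq']⟩

theorem norm_toLp_sq {α : Type*} [MeasurableSpace α] {μ : Measure α} {f : α → Vec d}
    (hf : MemLp f 2 μ) : ‖hf.toLp f‖ ^ 2 = ∫ x, ‖f x‖ ^ 2 ∂μ := by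
  rw [← real_inner_self_eq_norm_sq, L2.inner_def]
  refine integral_congr_ae ?_
  filter_upwards [hf.coeFn_toLp] with x hx
  rw [hx, real_inner_self_eq_norm_sq]

theorem memLp_of_continuous {f : Vec d → Vec d} (hf : Continuous f) (x : Vec d) (r : ℝ) :
    MemLp f 2 (volume.restrict (Metric.closedBall x r)) := by
  have : IsFiniteMeasure (volume.restrict (Metric.closedBall x r)) :=
    ⟨by simpa using (isCompact_closedBall x r).measure_lt_top⟩
  obtain ⟨C, hC⟩ := (isCompact_closedBall x r).exists_bound_of_continuousOn hf.continuousOn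
  exact MemLp.of_bound hf.aestronglyMeasurable C
    ((ae_restrict_iff' Metric.isClosed_closedBall.measurableSet).2 (.of_forall hC))

/-- Here `S` embeds polynomials in `L²` of the unit ball and `G` records value and derivative in the
sup norm on the ball of radius `κ`. The latter may be larger than the unit ball, since a polynomial
is determined by its values on any open set. -/
theorem exists_sq_le_integral_unitBall (d p : ℕ) (κ : ℝ) :
    ∃ C : ℝ, 0 < C ∧ ∀ v : Vec d → Vec d, IsVecPoly p v → ∀ x ∈ Metric.closedBall (0 : Vec d) κ,
      ‖v x‖ ^ 2 ≤ C * ∫ y in Metric.closedBall (0 : Vec d) 1, ‖v y‖ ^ 2 ∧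
      ‖fderiv ℝ v x‖ ^ 2 ≤ C * ∫ y in Metric.closedBall (0 : Vec d) 1, ‖v y‖ ^ 2 := by
  let B := Metric.closedBall (0 : Vec d) 1
  let K := Metric.closedBall (0 : Vec d) κ
  have : CompactSpace K := isCompact_iff_compactSpace.1 (isCompact_closedBall _ _)
  let S : vecPolySpace d p →ₗ[ℝ] Lp (Vec d) 2 (volume.restrict B) :=
    { toFun := fun v => (memLp_of_continuous v.2.continuous 0 1).toLp v.1
      map_add' := fun u v => MemLp.toLp_add _ _
      map_smul' := fun c u => MemLp.toLp_const_smul _ _ }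
  have hS : Function.Injective S := by
    rw [injective_iff_map_eq_zero]
    intro v hv
    have h0 : ∀ᵐ x ∂(volume.restrict (Metric.ball (0 : Vec d) 1)), v.1 x = 0 := by
      have h1 : v.1 =ᵐ[volume.restrict B] (0 : Vec d → Vec d) :=
        ((memLp_of_continuous v.2.continuous 0 1).coeFn_toLp.symm.trans
          (by rw [show MemLp.toLp v.1 _ = S v from rfl, hv])).trans (Lp.coeFn_zero _ _ _)
      exact ae_restrict_of_ae_restrict_of_subset Metric.ball_subset_closedBall h1
    have h2 : Set.EqOn v.1 0 (Metric.ball (0 : Vec d) 1) :=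
      Measure.eqOn_open_of_ae_eq h0 Metric.isOpen_ball v.2.continuous.continuousOn
        continuousOn_const
    ext1
    exact v.2.eq_zero_of_eventuallyEq (x := 0)
      (h2.eventuallyEq_of_mem (Metric.ball_mem_nhds _ one_pos))
  let G : vecPolySpace d p →ₗ[ℝ] C(K, Vec d × (Vec d →L[ℝ] Vec d)) :=
    { toFun := fun v => ⟨fun x => (v.1 x, fderiv ℝ v.1 x), by
        have h1 := v.2.continuous
        have h2 := v.2.continuous_fderiv
        fun_prop⟩
      map_add' := fun u v => by
        ext x : 1
        simp [fderiv_add (u.2.differentiable x.1) (v.2.differentiable x.1)]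
      map_smul' := fun c u => by
        ext x : 1
        simp [fderiv_const_smul (u.2.differentiable x.1)] }
  obtain ⟨C, hC, h⟩ := exists_norm_le_mul_norm_of_injective (E := C(K, Vec d × (Vec d →L[ℝ] Vec d))) S hS G
  -- The summand `1` only makes the constant strictly positive.
  refine ⟨C ^ 2 + 1, by positivity, fun v hv x hx => ?_⟩
  have h1 := (((G ⟨v, hv⟩).norm_coe_le_norm ⟨x, hx⟩).trans (h ⟨v, hv⟩))
  have h2 : ‖S ⟨v, hv⟩‖ ^ 2 = ∫ y in B, ‖v y‖ ^ 2 :=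
    norm_toLp_sq (memLp_of_continuous hv.continuous 0 1)
  have h3 : (C * ‖S ⟨v, hv⟩‖) ^ 2 ≤ (C ^ 2 + 1) * ∫ y in B, ‖v y‖ ^ 2 := by
    rw [mul_pow, ← h2]
    exact mul_le_mul_of_nonneg_right (by linarith) (sq_nonneg _)
  exact ⟨(pow_le_pow_left₀ (norm_nonneg _) ((norm_fst_le _).trans h1) 2).trans h3,
    (pow_le_pow_left₀ (norm_nonneg _) ((norm_snd_le _).trans h1) 2).trans h3⟩

theorem integral_closedBall_rescale (f : Vec d → ℝ) (x₀ : Vec d) {r : ℝ} (hr : 0 < r) :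
    ∫ y in Metric.closedBall x₀ r, f y =
      r ^ d * ∫ y in Metric.closedBall (0 : Vec d) 1, f (x₀ + r • y) := by
  have h := Measure.setIntegral_comp_smul_of_pos (volume : Measure (Vec d)) (fun y => f (x₀ + y))
    (Metric.closedBall 0 1) hr
  have h2 : ∫ y in Metric.closedBall x₀ r, f y = ∫ y in Metric.closedBall 0 r, f (x₀ + y) := by
    rw [← (measurePreserving_add_left volume x₀).setIntegral_preimage_emb
      (measurableEmbedding_addLeft x₀)]
    simp
  rw [h, h2, smul_closedBall r (0 : Vec d) zero_le_one, smul_zero, finrank_euclideanSpace_fin,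
    smul_eq_mul, Real.norm_of_nonneg hr.le, mul_one, mul_inv_cancel_left₀ (by positivity)]

/-- Substituting `x₀ + r y` produces `r ^ d` from the volume and one factor `r` per derivative.
Integrating over radius `r` while evaluating in radius `κ r` lets the inscribed ball control the
whole element. -/
theorem exists_sq_le_integral_ball (d p : ℕ) (κ : ℝ) :
    ∃ C : ℝ, 0 < C ∧ ∀ v : Vec d → Vec d, IsVecPoly p v → ∀ (x₀ : Vec d) (r : ℝ), 0 < r →
      ∀ x ∈ Metric.closedBall x₀ (κ * r),
      r ^ d * ‖v x‖ ^ 2 ≤ C * ∫ y in Metric.closedBall x₀ r, ‖v y‖ ^ 2 ∧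
      r ^ d * (r * ‖fderiv ℝ v x‖) ^ 2 ≤ C * ∫ y in Metric.closedBall x₀ r, ‖v y‖ ^ 2 := by
  obtain ⟨C, hC, h⟩ := exists_sq_le_integral_unitBall d p κ
  refine ⟨C, hC, fun v hv x₀ r hr x hx => ?_⟩
  have hx' : r⁻¹ • (x - x₀) ∈ Metric.closedBall (0 : Vec d) κ := by
    rw [mem_closedBall_zero_iff, norm_smul, norm_inv, Real.norm_of_nonneg hr.le,
      inv_mul_le_iff₀ hr, mul_comm, ← mem_closedBall_iff_norm]
    exact hx
  obtain ⟨h1, h2⟩ := h _ (hv.comp_affine x₀ r) _ hx'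
  have hxx : x₀ + r • r⁻¹ • (x - x₀) = x := by rw [smul_inv_smul₀ hr.ne']; abel
  have hd : fderiv ℝ (fun y => v (x₀ + r • y)) (r⁻¹ • (x - x₀)) = r • fderiv ℝ v x := by
    have h3 : HasFDerivAt (fun y : Vec d => x₀ + r • y) (r • ContinuousLinearMap.id ℝ (Vec d))
        (r⁻¹ • (x - x₀)) := ((hasFDerivAt_id _).const_smul r).const_add x₀
    have h4 : HasFDerivAt v (fderiv ℝ v x) (x₀ + r • r⁻¹ • (x - x₀)) := by
      rw [hxx]; exact (hv.differentiable x).hasFDerivAt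
    refine (HasFDerivAt.comp (r⁻¹ • (x - x₀)) h4 h3).fderiv.trans ?_
    ext w : 1
    simp
  rw [hxx] at h1
  rw [hd, norm_smul, Real.norm_of_nonneg hr.le] at h2
  rw [integral_closedBall_rescale _ x₀ hr, mul_left_comm]
  exact ⟨mul_le_mul_of_nonneg_left h1 (by positivity),
    mul_le_mul_of_nonneg_left h2 (by positivity)⟩

/-! ### Geometry of cells and facets -/

theorem isCompact_convexHull_finset (T : Finset (Vec d)) :
    IsCompact (convexHull ℝ (T : Set (Vec d))) :=
  T.finite_toSet.isCompact_convexHull ℝ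

theorem exists_ball_subset_cell (hd : 2 ≤ d) {T : Finset (Vec d)} (hT : T.card = d + 1)
    (hi : AffineIndependent ℝ ((↑) : T → Vec d)) {c : ℝ}
    (hc : Metric.diam (convexHull ℝ (T : Set (Vec d))) /
      inballDiam (convexHull ℝ (T : Set (Vec d))) ≤ c) :
    ∃ (x₀ : Vec d) (r : ℝ), 0 < r ∧
      Metric.closedBall x₀ r ⊆ convexHull ℝ (T : Set (Vec d)) ∧
      Metric.diam (convexHull ℝ (T : Set (Vec d))) ≤ 4 * max c 1 * r := by
  set K := convexHull ℝ (T : Set (Vec d)) with hK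
  have hKb : Bornology.IsBounded K := (isCompact_convexHull_finset T).isBounded
  have hint : (interior K).Nonempty := by
    rw [hK, interior_convexHull_nonempty_iff_affineSpan_eq_top]
    have := hi.affineSpan_eq_top_iff_card_eq_finrank_add_one
    rw [Subtype.range_coe] at this
    rw [this]
    simp [hT]
  set S := {r : ℝ | ∃ x, Metric.closedBall x r ⊆ K} with hS
  obtain ⟨x, hx⟩ := hint
  obtain ⟨ε, hε, hεK⟩ := Metric.nhds_basis_closedBall.mem_iff.1 (mem_interior_iff_mem_nhds.1 hx)
  have hεS : ε ∈ S := ⟨x, hεK⟩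
  have : Nonempty (Fin d) := ⟨⟨0, by omega⟩⟩
  have hbdd : BddAbove S := by
    refine ⟨max (Metric.diam K) 0, ?_⟩
    rintro r ⟨y, hy⟩
    -- Negative radii belong to `S`, since their closed balls are empty, so the diameter comparison
    -- is made only for `r > 0`.
    rcases le_or_gt r 0 with hr | hr
    · exact hr.trans (le_max_right _ _)
    · refine le_trans ?_ (le_max_left _ _)
      have h1 := Metric.diam_mono hy hKb
      have h2 : y + EuclideanSpace.single (Classical.arbitrary (Fin d)) r ∈ Metric.closedBall y r := by
        simp [abs_of_pos hr]
      have h3 := Metric.dist_le_diam_of_mem hKb (hy h2) (hy (Metric.mem_closedBall_self hr.le))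
      simpa [abs_of_pos hr] using h3
  have hpos : 0 < sSup S := hε.trans_le (le_csSup hbdd hεS)
  -- A radius above half the supremum avoids showing that the supremum is attained; with `inballDiam
  -- = 2 sSup S` this gives the factor `4`.
  obtain ⟨r, ⟨x₀, hr⟩, hlt⟩ := exists_lt_of_lt_csSup ⟨ε, hεS⟩ (half_lt_self hpos)
  refine ⟨x₀, r, by linarith, hr, ?_⟩
  have h1 : Metric.diam K ≤ c * (2 * sSup S) := (div_le_iff₀ (by positivity)).1 hc
  have h2 : c * (2 * sSup S) ≤ max c 1 * (2 * sSup S) :=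
    mul_le_mul_of_nonneg_right (le_max_left _ _) (by positivity)
  have h3 : max c 1 * (2 * sSup S) ≤ max c 1 * (4 * r) :=
    mul_le_mul_of_nonneg_left (by linarith) (by positivity)
  linarith

theorem facetDiam_pos (hd : 2 ≤ d) {F : Finset (Vec d)} (hF : F.card = d) : 0 < facetDiam F := by
  obtain ⟨x, hx, y, hy, hxy⟩ := Finset.one_lt_card.1 (show 1 < F.card by omega)
  refine (dist_pos.2 hxy).trans_le (Metric.dist_le_diam_of_mem
    (isCompact_convexHull_finset F).isBounded (subset_convexHull ℝ _ hx)
    (subset_convexHull ℝ _ hy))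

/-- The facet lies in the isometric image of a `(d - 1)`-dimensional ball of radius `h_F`. The
normalized Hausdorff measure is preserved by isometries and is Lebesgue measure on `Vec (d - 1)`. -/
theorem exists_facetMeasure_le (d : ℕ) : ∃ C : ℝ, 0 < C ∧ ∀ F : Finset (Vec d), F.card = d → 2 ≤ d →
    AffineIndependent ℝ ((↑) : F → Vec d) →
    (μHE[d - 1] : Measure (Vec d)) (convexHull ℝ (F : Set (Vec d))) ≤
      ENNReal.ofReal (C * facetDiam F ^ (d - 1)) := by
  refine ⟨(volume (Metric.closedBall (0 : Vec (d - 1)) 1)).toReal, ?_, fun F hF hd hi => ?_⟩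
  · exact ENNReal.toReal_pos (Metric.measure_closedBall_pos _ _ one_pos).ne'
      measure_closedBall_lt_top.ne
  obtain ⟨x, hx⟩ := Finset.card_pos.1 (show 0 < F.card by omega)
  set W := vectorSpan ℝ (F : Set (Vec d)) with hW
  have hfin : Module.finrank ℝ W = d - 1 := by
    have := hi.finrank_vectorSpan (n := d - 1) (by simp [hF]; omega)
    have hWr : W = vectorSpan ℝ (Set.range ((↑) : F → Vec d)) :=
      congrArg (vectorSpan ℝ) Subtype.range_coe.symm
    exact (LinearEquiv.ofEq _ _ hWr).finrank_eq.trans this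
  let e : Vec (d - 1) ≃ₗᵢ[ℝ] W :=
    (((stdOrthonormalBasis ℝ W).reindex (finCongr hfin)).repr).symm
  let f : Vec (d - 1) → Vec d := fun y => x + e y
  have hf : Isometry f := Isometry.of_dist_eq fun y z => by
    simp only [f, dist_add_left]
    exact e.dist_map y z
  have hsub : convexHull ℝ (F : Set (Vec d)) ⊆ f '' Metric.closedBall 0 (facetDiam F) := by
    intro y hy
    have hxF : x ∈ convexHull ℝ (F : Set (Vec d)) := subset_convexHull ℝ _ hx
    have h1 : y - x ∈ W := by
      rw [hW, ← direction_affineSpan]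
      exact AffineSubspace.vsub_mem_direction (convexHull_subset_affineSpan _ hy)
        (convexHull_subset_affineSpan _ hxF)
    refine ⟨e.symm ⟨y - x, h1⟩, ?_, by simp [f]⟩
    rw [mem_closedBall_zero_iff, LinearIsometryEquiv.norm_map]
    have := Metric.dist_le_diam_of_mem (isCompact_convexHull_finset F).isBounded hy hxF
    rw [dist_eq_norm] at this
    exact this
  refine (measure_mono hsub).trans ?_
  rw [hf.euclideanHausdorffMeasure_image, EuclideanSpace.euclideanHausdorffMeasure_eq_volume,
    Measure.addHaar_closedBall' _ _ (facetDiam_pos hd hF).le, finrank_euclideanSpace_fin, mul_comm,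
    ENNReal.ofReal_mul ENNReal.toReal_nonneg, ENNReal.ofReal_toReal measure_closedBall_lt_top.ne]

theorem norm_add_sq_le {E : Type*} [SeminormedAddCommGroup E] (x y : E) :
    ‖x + y‖ ^ 2 ≤ 2 * ‖x‖ ^ 2 + 2 * ‖y‖ ^ 2 := by
  nlinarith [norm_add_le x y, norm_nonneg (x + y), sq_nonneg (‖x‖ - ‖y‖), norm_nonneg x,
    norm_nonneg y]

/-- A discrete trace inequality for the streamline derivative along a Lipschitz field: the field is
replaced by a constant one, at the expense of `L² ‖v‖²` by the inverse inequality. -/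
theorem exists_conv_sq_le (d p : ℕ) {κ : ℝ} (hκ : 1 ≤ κ) :
    ∃ C : ℝ, 0 < C ∧ ∀ v : Vec d → Vec d, IsVecPoly p v → ∀ (x₀ : Vec d) (r : ℝ), 0 < r →
      ∀ (b : Vec d → Vec d) (L : ℝ) (S : Set (Vec d)), 0 ≤ L → ContinuousOn b S →
      Metric.closedBall x₀ r ⊆ S → S ⊆ Metric.closedBall x₀ (κ * r) →
      (∀ y ∈ S, ‖b y - b x₀‖ ≤ L * ‖y - x₀‖) → ∀ x ∈ S,
      r ^ d * ‖conv b v x‖ ^ 2 ≤ C * ∫ y in Metric.closedBall x₀ r,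
        (‖conv b v y‖ ^ 2 + L ^ 2 * ‖v y‖ ^ 2) := by
  obtain ⟨C, hC, h⟩ := exists_sq_le_integral_ball d p κ
  set ω := volume.real (Metric.closedBall (0 : Vec d) 1) with hω
  have hω0 : 0 ≤ ω := measureReal_nonneg
  -- The term `4 * C` is the coefficient of the integral of `‖conv b v‖²`; the other two collect the
  -- coefficients of `L ^ 2` times that of `‖v‖²`.
  refine ⟨4 * C + 2 * C * κ ^ 2 + 4 * C * (κ ^ 2 * ω * C), by positivity, ?_⟩
  intro v hv x₀ r hr b L S hL hb hBS hSκ hbL x hx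
  set B := Metric.closedBall x₀ r with hB
  have hBc : IsCompact B := isCompact_closedBall _ _
  have hbB : ContinuousOn b B := hb.mono hBS
  have hvc := hv.continuous
  have hvd := hv.continuous_fderiv
  have hcB : ContinuousOn (conv b v) B := hvd.continuousOn.clm_apply hbB
  have hI1 : IntegrableOn (fun y => ‖conv b v y‖ ^ 2) B :=
    (hcB.norm.pow 2).integrableOn_compact hBc
  have hI2 : IntegrableOn (fun y => ‖v y‖ ^ 2) B :=
    (hvc.norm.pow 2).continuousOn.integrableOn_compact hBc
  have hI3 : IntegrableOn (fun y => ‖fderiv ℝ v y‖ ^ 2) B :=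
    (hvd.norm.pow 2).continuousOn.integrableOn_compact hBc
  have hI3' : IntegrableOn (fun y => (r * ‖fderiv ℝ v y‖) ^ 2) B := by
    simp only [mul_pow]
    exact hI3.const_mul (r ^ 2)
  set X := ∫ y in B, ‖conv b v y‖ ^ 2
  set Y := ∫ y in B, ‖v y‖ ^ 2
  have hX : 0 ≤ X := integral_nonneg fun y => by positivity
  have hY : 0 ≤ Y := integral_nonneg fun y => by positivity
  have hsum : ∫ y in B, (‖conv b v y‖ ^ 2 + L ^ 2 * ‖v y‖ ^ 2) = X + L ^ 2 * Y := by
    rw [integral_add hI1 (hI2.const_mul _), integral_const_mul]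
  -- the difference of the two streamline derivatives
  have hdiff : ∀ y ∈ S, ‖fderiv ℝ v y (b y - b x₀)‖ ^ 2 ≤
      L ^ 2 * κ ^ 2 * (r * ‖fderiv ℝ v y‖) ^ 2 := by
    intro y hy
    have h1 : ‖b y - b x₀‖ ≤ L * (κ * r) := (hbL y hy).trans
      (mul_le_mul_of_nonneg_left (mem_closedBall_iff_norm.1 (hSκ hy)) hL)
    have h2 : ‖fderiv ℝ v y (b y - b x₀)‖ ≤ ‖fderiv ℝ v y‖ * (L * (κ * r)) :=
      (ContinuousLinearMap.le_opNorm _ _).trans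
        (mul_le_mul_of_nonneg_left h1 (norm_nonneg _))
    calc _ ≤ (‖fderiv ℝ v y‖ * (L * (κ * r))) ^ 2 := pow_le_pow_left₀ (norm_nonneg _) h2 2
      _ = _ := by ring
  -- The pointwise inverse inequality is integrated over the ball, whose volume `ω r ^ d` cancels
  -- the factor `r ^ d`.
  have hgrad : ∫ y in B, (r * ‖fderiv ℝ v y‖) ^ 2 ≤ ω * (C * Y) := by
    have hr' : 0 < r ^ d := by positivity
    have h1 : ∀ y ∈ B, (r * ‖fderiv ℝ v y‖) ^ 2 ≤ C * Y / r ^ d := fun y hy => by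
      rw [le_div_iff₀ hr', mul_comm]
      exact (h v hv x₀ r hr y (Metric.closedBall_subset_closedBall
        (le_mul_of_one_le_left hr.le hκ) hy)).2
    have h2 := setIntegral_mono_on (s := B) (μ := volume)
      hI3'
      (integrableOn_const hBc.measure_lt_top.ne) Metric.isClosed_closedBall.measurableSet h1
    rw [setIntegral_const, hB, Measure.real, Measure.addHaar_closedBall' _ _ hr.le,
      finrank_euclideanSpace_fin, ENNReal.toReal_mul, ENNReal.toReal_ofReal hr'.le] at h2
    refine h2.trans (le_of_eq ?_)
    rw [hω, Measure.real, smul_eq_mul]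
    field_simp
  -- Freezing is used twice: at `x` to reach a polynomial, and here under the integral to return to
  -- the streamline derivative along `b`.
  have hw : ∫ y in B, ‖fderiv ℝ v y (b x₀)‖ ^ 2 ≤ 2 * X + 2 * (L ^ 2 * κ ^ 2 * (ω * (C * Y))) := by
    have h1 : ∀ y ∈ B, ‖fderiv ℝ v y (b x₀)‖ ^ 2 ≤
        2 * ‖conv b v y‖ ^ 2 + 2 * (L ^ 2 * κ ^ 2 * (r * ‖fderiv ℝ v y‖) ^ 2) := fun y hy => by
      have h2 := norm_add_sq_le (conv b v y) (-fderiv ℝ v y (b y - b x₀))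
      rw [norm_neg, show conv b v y + -fderiv ℝ v y (b y - b x₀) = fderiv ℝ v y (b x₀) by
        simp [conv]] at h2
      linarith [hdiff y (hBS hy)]
    have h2 := setIntegral_mono_on (s := B) (μ := volume)
      (((hv.fderiv_apply (b x₀)).continuous.norm.pow 2).continuousOn.integrableOn_compact hBc)
      ((hI1.const_mul 2).add ((hI3'.const_mul (L ^ 2 * κ ^ 2)).const_mul 2))
      Metric.isClosed_closedBall.measurableSet h1
    refine h2.trans ?_
    simp only [Pi.add_apply]
    rw [integral_add (hI1.const_mul 2) ((hI3'.const_mul (L ^ 2 * κ ^ 2)).const_mul 2),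
      integral_const_mul, integral_const_mul, integral_const_mul]
    gcongr
  have e1 := (h _ (hv.fderiv_apply (b x₀)) x₀ r hr x (hSκ hx)).1
  have e2 := (h v hv x₀ r hr x (hSκ hx)).2
  have e3 := norm_add_sq_le (fderiv ℝ v x (b x₀)) (fderiv ℝ v x (b x - b x₀))
  rw [show fderiv ℝ v x (b x₀) + fderiv ℝ v x (b x - b x₀) = conv b v x by simp [conv]] at e3
  rw [hsum]
  have hr' : 0 < r ^ d := by positivity
  calc r ^ d * ‖conv b v x‖ ^ 2
      ≤ r ^ d * (2 * ‖fderiv ℝ v x (b x₀)‖ ^ 2 + 2 * (L ^ 2 * κ ^ 2 * (r * ‖fderiv ℝ v x‖) ^ 2)) := by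
        gcongr
        linarith [hdiff x hx]
    _ = 2 * (r ^ d * ‖fderiv ℝ v x (b x₀)‖ ^ 2)
        + 2 * L ^ 2 * κ ^ 2 * (r ^ d * (r * ‖fderiv ℝ v x‖) ^ 2) := by ring
    _ ≤ 2 * (C * (2 * X + 2 * (L ^ 2 * κ ^ 2 * (ω * (C * Y))))) + 2 * L ^ 2 * κ ^ 2 * (C * Y) := by
        refine add_le_add (mul_le_mul_of_nonneg_left (e1.trans ?_) zero_le_two)
          (mul_le_mul_of_nonneg_left e2 (by positivity))
        exact mul_le_mul_of_nonneg_left hw hC.le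
    _ = 4 * C * X + (2 * C * κ ^ 2 + 4 * C * (κ ^ 2 * ω * C)) * (L ^ 2 * Y) := by ring
    _ ≤ _ := by
        have hLY : 0 ≤ L ^ 2 * Y := by positivity
        have k1 : 0 ≤ (2 * C * κ ^ 2 + 4 * C * (κ ^ 2 * ω * C)) * X := by positivity
        have k2 : 0 ≤ 4 * C * (L ^ 2 * Y) := by positivity
        linarith

/-! ### Traces and Young's inequality on a facet -/

/-- A sup bound on the facet times its measure. The scaling closes because `h * h ^ m ≤ (κ r) ^ (m +
1)` matches the factor `r ^ (m + 1)` in `hΦ`; the weight is replaced by its extreme values and costs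
the ratio `R`. -/
theorem mul_setIntegral_facet_le {α : Type*} [MeasurableSpace α] {μ ν : Measure α} {F B T : Set α}
    {g Φ Ψ : α → ℝ} {m : ℕ} {h r κ C Cf gmin gmax R : ℝ} (hh : 0 ≤ h) (hr : 0 < r)
    (hhr : h ≤ κ * r) (hC : 0 ≤ C) (hCf : 0 ≤ Cf) (hFT : F ⊆ T) (hBT : B ⊆ T)
    (hFn : F.Nonempty) (hT : MeasurableSet T)
    (hμ : μ F ≤ ENNReal.ofReal (Cf * h ^ m)) (hmin : 0 < gmin) (hR : gmax ≤ R * gmin)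
    (hg : ∀ x ∈ T, gmin ≤ g x ∧ g x ≤ gmax) (hΦ0 : ∀ x, 0 ≤ Φ x) (hΨ0 : ∀ x, 0 ≤ Ψ x)
    (hΨ : IntegrableOn Ψ T ν) (hgΨ : IntegrableOn (fun x => g x * Ψ x) T ν)
    (hΦ : ∀ x ∈ T, r ^ (m + 1) * Φ x ≤ C * ∫ y in B, Ψ y ∂ν) :
    h * ∫ x in F, g x * Φ x ∂μ ≤ C * (Cf * κ ^ (m + 1)) * R * ∫ x in T, g x * Ψ x ∂ν := by
  obtain ⟨x₁, hx₁⟩ := hFn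
  have hmax : 0 < gmax := hmin.trans_le ((hg _ (hFT hx₁)).1.trans (hg _ (hFT hx₁)).2)
  set I := ∫ y in T, Ψ y ∂ν with hI
  have hI0 : 0 ≤ I := integral_nonneg hΨ0
  have hBI : ∫ y in B, Ψ y ∂ν ≤ I :=
    setIntegral_mono_set hΨ (.of_forall hΨ0) (.of_forall hBT)
  have hgI : gmin * I ≤ ∫ x in T, g x * Ψ x ∂ν := by
    rw [hI, ← integral_const_mul]
    exact setIntegral_mono_on (hΨ.const_mul _) hgΨ hT fun x hx =>
      mul_le_mul_of_nonneg_right (hg x hx).1 (hΨ0 x)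
  have hpt : ∀ x ∈ F, ‖g x * Φ x‖ ≤ gmax * (C * I / r ^ (m + 1)) := fun x hx => by
    have hgx := hg x (hFT hx)
    rw [Real.norm_of_nonneg (mul_nonneg (hmin.le.trans hgx.1) (hΦ0 x))]
    refine mul_le_mul hgx.2 ?_ (hΦ0 x) hmax.le
    rw [le_div_iff₀ (by positivity), mul_comm]
    exact (hΦ x (hFT hx)).trans (mul_le_mul_of_nonneg_left hBI hC)
  have hfin : μ F < ∞ := hμ.trans_lt ENNReal.ofReal_lt_top
  have h1 := (le_abs_self _).trans (norm_setIntegral_le_of_norm_le_const hfin hpt)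
  have h2 : μ.real F ≤ Cf * h ^ m := ENNReal.toReal_le_of_le_ofReal (by positivity) hμ
  have hκ : 0 ≤ κ := nonneg_of_mul_nonneg_left (hh.trans hhr) hr
  calc h * ∫ x in F, g x * Φ x ∂μ
      ≤ h * (gmax * (C * I / r ^ (m + 1)) * (Cf * h ^ m)) := by
        gcongr
        exact h1.trans (by gcongr)
    _ = gmax * (C * I / r ^ (m + 1)) * Cf * h ^ (m + 1) := by ring
    _ ≤ gmax * (C * I / r ^ (m + 1)) * Cf * (κ * r) ^ (m + 1) := by gcongr
    _ = C * (Cf * κ ^ (m + 1)) * (gmax * I) := by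
        rw [mul_pow]; field_simp
    _ ≤ C * (Cf * κ ^ (m + 1)) * (R * ∫ x in T, g x * Ψ x ∂ν) := by
        have h3 : gmax * I ≤ R * gmin * I := mul_le_mul_of_nonneg_right hR hI0
        have h4 : 0 ≤ R := (pos_of_mul_pos_left (hmax.trans_le hR) hmin.le).le
        refine mul_le_mul_of_nonneg_left (h3.trans ?_) (by positivity)
        rw [mul_assoc]
        exact mul_le_mul_of_nonneg_left hgI h4
    _ = _ := by ring

theorem setIntegral_penalty_ge {α E : Type*} [MeasurableSpace α] {μ : Measure α}
    [NormedAddCommGroup E] [InnerProductSpace ℝ E] {F : Set α} {g : α → ℝ} {A J : α → E}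
    {h ε lam : ℝ} (hh : 0 < h) (hε : 0 < ε) (hF : MeasurableSet F) (hg : ∀ x ∈ F, 0 ≤ g x)
    (hA : IntegrableOn (fun x => g x * ‖A x‖ ^ 2) F μ)
    (hJ : IntegrableOn (fun x => g x * ‖J x‖ ^ 2) F μ)
    (hAJ : IntegrableOn (fun x => g x * ⟪A x, J x⟫_ℝ) F μ) :
    (lam - ε⁻¹) * ∫ x in F, h⁻¹ * (g x * ‖J x‖ ^ 2) ∂μ
        - ε * (h * ∫ x in F, g x * ‖A x‖ ^ 2 ∂μ) ≤
      ∫ x in F, g x * (lam / h) * ⟪J x, J x⟫_ℝ ∂μ - 2 * ∫ x in F, g x * ⟪A x, J x⟫_ℝ ∂μ := by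
  have h1 : ∫ x in F, g x * (lam / h) * ⟪J x, J x⟫_ℝ ∂μ =
      lam * h⁻¹ * ∫ x in F, g x * ‖J x‖ ^ 2 ∂μ := by
    rw [← integral_const_mul]
    congr with x
    rw [real_inner_self_eq_norm_sq]
    ring
  have h2 := setIntegral_mono_on (hAJ.const_mul 2)
    ((hA.const_mul (ε * h)).add (hJ.const_mul (ε⁻¹ * h⁻¹))) hF fun x hx => by
      have h3 : 2 * ⟪A x, J x⟫_ℝ ≤ ε * h * ‖A x‖ ^ 2 + ε⁻¹ * h⁻¹ * ‖J x‖ ^ 2 := by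
        have h4 := real_inner_le_norm (A x) (J x)
        -- Young's inequality with weight `ε h`, as a completed square.
        have h5 : 0 ≤ ε * h * (‖A x‖ - ε⁻¹ * h⁻¹ * ‖J x‖) ^ 2 := by positivity
        have h6 : ε * h * (‖A x‖ - ε⁻¹ * h⁻¹ * ‖J x‖) ^ 2 =
          ε * h * ‖A x‖ ^ 2 + ε⁻¹ * h⁻¹ * ‖J x‖ ^ 2 - 2 * (‖A x‖ * ‖J x‖) := by
          field_simp
          ring
        linarith
      have := mul_le_mul_of_nonneg_left h3 (hg x hx)
      simp only [Pi.add_apply]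
      linarith
  simp only [Pi.add_apply] at h2
  rw [integral_add (hA.const_mul _) (hJ.const_mul _), integral_const_mul, integral_const_mul,
    integral_const_mul] at h2
  rw [h1, integral_const_mul]
  linarith

/-! ### Bilinear forms -/

section Bilinear

variable {V : Type*} [AddCommGroup V] [Module ℝ V]

/-- The function `f` of two variables is a bilinear form. -/
def IsBilin (f : V → V → ℝ) : Prop := ∃ B : LinearMap.BilinForm ℝ V, ∀ u v, B u v = f u v

theorem IsBilin.add {f g : V → V → ℝ} (hf : IsBilin f) (hg : IsBilin g) :
    IsBilin fun u v => f u v + g u v := by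
  obtain ⟨A, hA⟩ := hf
  obtain ⟨B, hB⟩ := hg
  exact ⟨A + B, fun u v => by simp [hA, hB]⟩

theorem IsBilin.sub {f g : V → V → ℝ} (hf : IsBilin f) (hg : IsBilin g) :
    IsBilin fun u v => f u v - g u v := by
  obtain ⟨A, hA⟩ := hf
  obtain ⟨B, hB⟩ := hg
  exact ⟨A - B, fun u v => by simp [hA, hB]⟩

theorem IsBilin.congr {f g : V → V → ℝ} (hf : IsBilin f) (h : ∀ u v, f u v = g u v) :
    IsBilin g := by
  obtain ⟨A, hA⟩ := hf
  exact ⟨A, fun u v => (hA u v).trans (h u v)⟩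

theorem IsBilin.flip {f : V → V → ℝ} (hf : IsBilin f) : IsBilin fun u v => f v u := by
  obtain ⟨A, hA⟩ := hf
  exact ⟨A.flip, fun u v => by simp [hA]⟩

theorem IsBilin.sum {ι : Type*} {s : Finset ι} {f : ι → V → V → ℝ} (hf : ∀ i ∈ s, IsBilin (f i)) :
    IsBilin fun u v => ∑ i ∈ s, f i u v := by
  classical
  induction s using Finset.induction_on with
  | empty => exact ⟨0, by simp⟩
  | insert i s hi ih =>
    simp only [Finset.sum_insert hi]
    exact (hf i (Finset.mem_insert_self i s)).add
      (ih fun j hj => hf j (Finset.mem_insert_of_mem hj))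

theorem isBilin_setIntegral {α E : Type*} [MeasurableSpace α] {μ : Measure α} {S : Set α}
    [NormedAddCommGroup E] [InnerProductSpace ℝ E] (g : α → ℝ) (P Q : V →ₗ[ℝ] (α → E))
    (h : ∀ u v, IntegrableOn (fun x => g x * ⟪P u x, Q v x⟫_ℝ) S μ) :
    IsBilin fun u v => ∫ x in S, g x * ⟪P u x, Q v x⟫_ℝ ∂μ := by
  refine ⟨LinearMap.mk₂ ℝ (fun u v => ∫ x in S, g x * ⟪P u x, Q v x⟫_ℝ ∂μ) ?_ ?_ ?_ ?_,
    fun u v => rfl⟩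
  · intro u u' v
    rw [← integral_add (h u v) (h u' v)]
    simp [inner_add_left, mul_add]
  · intro c u v
    rw [smul_eq_mul, ← integral_const_mul]
    simp [real_inner_smul_left, mul_left_comm]
  · intro u v v'
    rw [← integral_add (h u v) (h u v')]
    simp [inner_add_right, mul_add]
  · intro c u v
    rw [smul_eq_mul, ← integral_const_mul]
    simp [real_inner_smul_right, mul_left_comm]

/-- The triangle inequality for `√(f u u)` is Cauchy–Schwarz, which needs only semidefiniteness. -/
theorem IsBilin.exists_seminorm {f : V → V → ℝ} (hf : IsBilin f) (hs : ∀ u v, f u v = f v u)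
    (h0 : ∀ u, 0 ≤ f u u) : ∃ N : Seminorm ℝ V, ∀ u, N u ^ 2 = f u u := by
  obtain ⟨B, hB⟩ := hf
  have hB0 : ∀ u, 0 ≤ B u u := fun u => by rw [hB]; exact h0 u
  refine ⟨Seminorm.of (fun u => √(B u u)) (fun u v => ?_) (fun c u => ?_), fun u => ?_⟩
  · have h1 := LinearMap.BilinForm.apply_mul_apply_le_of_forall_zero_le B hB0 u v
    have h2 : B v u = B u v := by rw [hB, hB, hs]
    have h3 : B u v ≤ √(B u u) * √(B v v) := by
      rw [← Real.sqrt_mul (hB0 u)]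
      exact Real.le_sqrt_of_sq_le (by rw [h2] at h1; linarith)
    rw [Real.sqrt_le_left (by positivity), add_sq, Real.sq_sqrt (hB0 u), Real.sq_sqrt (hB0 v)]
    simp only [map_add, LinearMap.add_apply, h2]
    linarith
  · simp only [map_smul, LinearMap.smul_apply, smul_eq_mul]
    rw [← mul_assoc, Real.sqrt_mul (mul_self_nonneg c), Real.sqrt_mul_self_eq_abs, Real.norm_eq_abs]
  · exact (Real.sq_sqrt (hB0 u)).trans (hB u u)

end Bilinear

/-! ### Integrals on a mesh -/

section Mesh

variable {𝒯 : SimplicialMesh d}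

theorem SimplicialMesh.mem_cells {T : Finset (Vec d)} :
    T ∈ 𝒯.cells ↔ T ∈ 𝒯.faces ∧ T.card = d + 1 := by
  simp [SimplicialMesh.cells]

theorem SimplicialMesh.mem_facets {F : Finset (Vec d)} :
    F ∈ 𝒯.facets ↔ F ∈ 𝒯.faces ∧ F.card = d := by
  simp [SimplicialMesh.facets]

theorem SimplicialMesh.mem_adj {F : Finset (Vec d)} {T : 𝒯.cells} : T ∈ 𝒯.adj F ↔ F ⊆ T.1 := by
  simp [SimplicialMesh.adj]

theorem SimplicialMesh.cell_subset (T : 𝒯.cells) :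
    convexHull ℝ (T.1 : Set (Vec d)) ⊆ 𝒯.closedDomain :=
  Set.subset_biUnion_of_mem (u := fun T : Finset (Vec d) => convexHull ℝ (T : Set (Vec d))) T.2

theorem SimplicialMesh.facet_subset {F : Finset (Vec d)} (hF : F ∈ 𝒯.facets) :
    convexHull ℝ (F : Set (Vec d)) ⊆ 𝒯.closedDomain := by
  obtain ⟨T, hT, hFT, hc⟩ := 𝒯.pure F (SimplicialMesh.mem_facets.1 hF).1
  exact (convexHull_mono (by exact_mod_cast hFT)).trans
    (SimplicialMesh.cell_subset ⟨T, SimplicialMesh.mem_cells.2 ⟨hT, hc⟩⟩)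

theorem SimplicialMesh.integrableOn_cell {f : Vec d → ℝ} (hf : ContinuousOn f 𝒯.closedDomain)
    (T : 𝒯.cells) : IntegrableOn f (convexHull ℝ (T.1 : Set (Vec d))) :=
  (hf.mono (SimplicialMesh.cell_subset T)).integrableOn_compact (isCompact_convexHull_finset _)

theorem SimplicialMesh.integrableOn_facet (hd : 2 ≤ d) {f : Vec d → ℝ}
    (hf : ContinuousOn f 𝒯.closedDomain) {F : Finset (Vec d)} (hF : F ∈ 𝒯.facets) :
    IntegrableOn f (convexHull ℝ (F : Set (Vec d))) μHE[d - 1] := by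
  obtain ⟨C, -, hC⟩ := exists_facetMeasure_le d
  have hF' := SimplicialMesh.mem_facets.1 hF
  have hc := isCompact_convexHull_finset F
  have hfF := hf.mono (SimplicialMesh.facet_subset hF)
  obtain ⟨K, hK⟩ := hc.exists_bound_of_continuousOn hfF
  exact IntegrableOn.of_bound ((hC F hF'.2 hd (𝒯.indep hF'.1)).trans_lt ENNReal.ofReal_lt_top)
    (hfF.aestronglyMeasurable hc.measurableSet) K
    ((ae_restrict_iff' hc.measurableSet).2 (.of_forall hK))

/-- Facets of `T` are `d`-element subsets of its `d + 1` vertices. This bounds how often an element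
is counted when facet estimates are summed. -/
theorem SimplicialMesh.card_facets_filter_subset_le (T : 𝒯.cells) :
    ((𝒯.facets.filter fun F => F ⊆ T.1).card : ℝ) ≤ d + 1 := by
  have h1 : (𝒯.facets.filter fun F => F ⊆ T.1) ⊆ T.1.powersetCard d := fun F hF => by
    rw [Finset.mem_filter, SimplicialMesh.mem_facets] at hF
    exact Finset.mem_powersetCard.2 ⟨hF.2, hF.1.2⟩
  have h2 := Finset.card_le_card h1
  rw [Finset.card_powersetCard, (SimplicialMesh.mem_cells.1 T.2).2, Nat.choose_succ_self_right] at h2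
  exact_mod_cast h2

/-- Cauchy–Schwarz yields the factor `n⁻² * n ≤ 1` for any number `n` of adjacent elements, so it is
not necessary to know that `n ≤ 2`. -/
theorem norm_avg_sq_le {E : Type*} [NormedAddCommGroup E] [NormedSpace ℝ E] (F : Finset (Vec d))
    (w : 𝒯.cells → Vec d → E) (x : Vec d) :
    ‖avg 𝒯 F w x‖ ^ 2 ≤ ∑ T ∈ 𝒯.adj F, ‖w T x‖ ^ 2 := by
  set n := (𝒯.adj F).card with hn
  rcases Nat.eq_zero_or_pos n with h0 | h0
  · rw [avg, ← hn, h0]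
    simpa using Finset.sum_nonneg fun T _ => sq_nonneg ‖w T x‖
  have h1 : (1 : ℝ) ≤ n := by exact_mod_cast h0
  have h2 : ‖∑ T ∈ 𝒯.adj F, w T x‖ ^ 2 ≤ n * ∑ T ∈ 𝒯.adj F, ‖w T x‖ ^ 2 :=
    (pow_le_pow_left₀ (norm_nonneg _) (norm_sum_le _ _) 2).trans sq_sum_le_card_mul_sum_sq
  have h3 : 0 ≤ ∑ T ∈ 𝒯.adj F, ‖w T x‖ ^ 2 := Finset.sum_nonneg fun T _ => sq_nonneg _
  rw [avg, ← hn, norm_smul, mul_pow, norm_inv, Real.norm_natCast, inv_pow,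
    inv_mul_le_iff₀ (by positivity)]
  refine h2.trans (mul_le_mul_of_nonneg_right ?_ h3)
  nlinarith

theorem continuousOn_avg {E : Type*} [NormedAddCommGroup E] [NormedSpace ℝ E] (F : Finset (Vec d))
    {w : 𝒯.cells → Vec d → E} {S : Set (Vec d)} (hw : ∀ T, ContinuousOn (w T) S) :
    ContinuousOn (avg 𝒯 F w) S :=
  (continuousOn_finsetSum _ fun T _ => hw T).const_smul _

/-- Trace inequalities on the individual elements bound the averages on all facets. -/
theorem sum_facetInt_avg_le {E : Type*} [NormedAddCommGroup E] [NormedSpace ℝ E] (hd : 2 ≤ d)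
    {g : Vec d → ℝ} {w : 𝒯.cells → Vec d → E} {Ψ : 𝒯.cells → ℝ} {M : ℝ} (hM : 0 ≤ M)
    (hg : ContinuousOn g 𝒯.closedDomain) (hg0 : ∀ x ∈ 𝒯.closedDomain, 0 ≤ g x)
    (hw : ∀ T, ContinuousOn (w T) 𝒯.closedDomain) (hΨ : ∀ T, 0 ≤ Ψ T)
    (h : ∀ T, ∀ F ∈ 𝒯.facets, F ⊆ T.1 →
      facetDiam F * facetInt F (fun x => g x * ‖w T x‖ ^ 2) ≤ M * Ψ T) :
    ∑ F ∈ 𝒯.facets, facetDiam F * facetInt F (fun x => g x * ‖avg 𝒯 F w x‖ ^ 2) ≤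
      (d + 1) * M * ∑ T, Ψ T := by
  have hint : ∀ F ∈ 𝒯.facets, ∀ T, IntegrableOn (fun x => g x * ‖w T x‖ ^ 2)
      (convexHull ℝ (F : Set (Vec d))) μHE[d - 1] := fun F hF T =>
    SimplicialMesh.integrableOn_facet hd (hg.mul ((hw T).norm.pow 2)) hF
  have h1 : ∀ F ∈ 𝒯.facets, facetDiam F * facetInt F (fun x => g x * ‖avg 𝒯 F w x‖ ^ 2) ≤
      ∑ T, if F ⊆ T.1 then M * Ψ T else 0 := by
    intro F hF
    have h2 : facetInt F (fun x => g x * ‖avg 𝒯 F w x‖ ^ 2) ≤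
        ∑ T ∈ 𝒯.adj F, facetInt F (fun x => g x * ‖w T x‖ ^ 2) := by
      unfold facetInt
      rw [← integral_finsetSum _ fun T _ => hint F hF T]
      refine setIntegral_mono_on
        (SimplicialMesh.integrableOn_facet hd (hg.mul ((continuousOn_avg F hw).norm.pow 2)) hF)
        (integrable_finsetSum _ fun T _ => hint F hF T)
        (isCompact_convexHull_finset F).measurableSet fun x hx => ?_
      rw [← Finset.mul_sum]
      exact mul_le_mul_of_nonneg_left (norm_avg_sq_le F w x)
        (hg0 x (SimplicialMesh.facet_subset hF hx))
    refine (mul_le_mul_of_nonneg_left h2 Metric.diam_nonneg).trans ?_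
    rw [Finset.mul_sum, ← Finset.sum_filter]
    refine (Finset.sum_le_sum fun T hT => h T F hF (SimplicialMesh.mem_adj.1 hT)).trans
      (le_of_eq (Finset.sum_congr ?_ fun _ _ => rfl))
    ext T
    simp [SimplicialMesh.mem_adj]
  refine (Finset.sum_le_sum h1).trans ?_
  -- Exchanging the sums groups the contributions by element, each receiving at most `d + 1` of
  -- them.
  rw [Finset.sum_comm, Finset.mul_sum]
  refine Finset.sum_le_sum fun T _ => ?_
  rw [← Finset.sum_filter, Finset.sum_const, nsmul_eq_mul, mul_assoc]
  exact mul_le_mul_of_nonneg_right (SimplicialMesh.card_facets_filter_subset_le T)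
    (mul_nonneg hM (hΨ T))

/-- The interior penalty terms are bounded from below, once the averages are controlled. -/
theorem sum_facetInt_penalty_ge {E : Type*} [NormedAddCommGroup E] [InnerProductSpace ℝ E]
    (hd : 2 ≤ d) {g : Vec d → ℝ} {A J : Finset (Vec d) → Vec d → E} {lam ε : ℝ} (hε : 0 < ε)
    (hg : ContinuousOn g 𝒯.closedDomain) (hg0 : ∀ x ∈ 𝒯.closedDomain, 0 ≤ g x)
    (hA : ∀ F, ContinuousOn (A F) 𝒯.closedDomain) (hJ : ∀ F, ContinuousOn (J F) 𝒯.closedDomain) :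
    (lam - ε⁻¹) * ∑ F ∈ 𝒯.facets, facetInt F (fun x => (facetDiam F)⁻¹ * (g x * ‖J F x‖ ^ 2))
        - ε * ∑ F ∈ 𝒯.facets, facetDiam F * facetInt F (fun x => g x * ‖A F x‖ ^ 2) ≤
      ∑ F ∈ 𝒯.facets, facetInt F (fun x => g x * (lam / facetDiam F) * ⟪J F x, J F x⟫_ℝ)
        - 2 * ∑ F ∈ 𝒯.facets, facetInt F (fun x => g x * ⟪A F x, J F x⟫_ℝ) := by
  rw [Finset.mul_sum, Finset.mul_sum, Finset.mul_sum, ← Finset.sum_sub_distrib,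
    ← Finset.sum_sub_distrib]
  exact Finset.sum_le_sum fun F hF => setIntegral_penalty_ge
    (facetDiam_pos hd (SimplicialMesh.mem_facets.1 hF).2) hε
    (isCompact_convexHull_finset F).measurableSet
    (fun x hx => hg0 x (SimplicialMesh.facet_subset hF hx))
    (SimplicialMesh.integrableOn_facet hd (hg.mul ((hA F).norm.pow 2)) hF)
    (SimplicialMesh.integrableOn_facet hd (hg.mul ((hJ F).norm.pow 2)) hF)
    (SimplicialMesh.integrableOn_facet hd (hg.mul ((hA F).inner (𝕜 := ℝ) (hJ F))) hF)

end Mesh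

/-- Discrete trace inequalities: the streamline derivative along a Lipschitz field, and the
divergence, of a polynomial on a facet are bounded by their values on an adjacent element. -/
theorem exists_trace_le (d p : ℕ) (hd : 2 ≤ d) (cT : ℝ) :
    ∃ M : ℝ, 0 < M ∧ ∀ 𝒯 : SimplicialMesh d, 𝒯.ShapeRegular cT →
      ∀ (g : Vec d → ℝ) (gmin gmax R : ℝ), ContinuousOn g 𝒯.closedDomain → 0 < gmin →
      (∀ x ∈ 𝒯.closedDomain, gmin ≤ g x ∧ g x ≤ gmax) → gmax ≤ R * gmin →
      ∀ T : 𝒯.cells, ∀ F ∈ 𝒯.facets, F ⊆ T.1 → ∀ v : Vec d → Vec d, IsVecPoly p v →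
      (∀ (b : Vec d → Vec d) (L : ℝ≥0), LipschitzOnWith L b 𝒯.closedDomain →
        facetDiam F * facetInt F (fun x => g x * ‖conv b v x‖ ^ 2) ≤
          M * R * 𝒯.cellInt T fun x => g x * (‖conv b v x‖ ^ 2 + (L : ℝ) ^ 2 * ‖v x‖ ^ 2)) ∧
      facetDiam F * facetInt F (fun x => g x * ‖divg v x‖ ^ 2) ≤
          M * R * 𝒯.cellInt T fun x => g x * ‖divg v x‖ ^ 2 := by
  set κ : ℝ := 4 * max cT 1 with hκ
  have hκ1 : 1 ≤ κ := by linarith [le_max_right cT 1]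
  obtain ⟨C₁, hC₁, h₁⟩ := exists_conv_sq_le d p hκ1
  obtain ⟨C₂, hC₂, h₂⟩ := exists_sq_le_integral_ball d p κ
  obtain ⟨Cf, hCf, hf⟩ := exists_facetMeasure_le d
  refine ⟨(C₁ + C₂) * (Cf * κ ^ (d - 1 + 1)), by positivity, ?_⟩
  intro 𝒯 hreg g gmin gmax R hg hmin hgb hR T F hF hFT v hv
  have hT := SimplicialMesh.mem_cells.1 T.2
  have hF' := SimplicialMesh.mem_facets.1 hF
  obtain ⟨x₀, r, hr, hB, hdiam⟩ := exists_ball_subset_cell hd hT.2 (𝒯.indep hT.1) (hreg T.1 T.2)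
  have hTc := isCompact_convexHull_finset T.1
  have hFT' : convexHull ℝ (F : Set (Vec d)) ⊆ convexHull ℝ (T.1 : Set (Vec d)) :=
    convexHull_mono (by exact_mod_cast hFT)
  have hhr : facetDiam F ≤ κ * r := (Metric.diam_mono hFT' hTc.isBounded).trans hdiam
  have hx₀ : x₀ ∈ convexHull ℝ (T.1 : Set (Vec d)) := hB (Metric.mem_closedBall_self hr.le)
  have hTκ : convexHull ℝ (T.1 : Set (Vec d)) ⊆ Metric.closedBall x₀ (κ * r) := fun x hx =>
    Metric.mem_closedBall.2 ((Metric.dist_le_diam_of_mem hTc.isBounded hx hx₀).trans hdiam)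
  have hsub := SimplicialMesh.cell_subset T
  have hd1 : d - 1 + 1 = d := by omega
  have hFn : (convexHull ℝ (F : Set (Vec d))).Nonempty := by
    rw [convexHull_nonempty_iff]
    exact_mod_cast Finset.card_pos.1 (show 0 < F.card by omega)
  -- the common part of both inequalities
  have key : ∀ (C : ℝ) (Φ Ψ : Vec d → ℝ), 0 < C → C ≤ C₁ + C₂ → (∀ x, 0 ≤ Φ x) → (∀ x, 0 ≤ Ψ x) →
      ContinuousOn Ψ 𝒯.closedDomain → (∀ x ∈ convexHull ℝ (T.1 : Set (Vec d)),
        r ^ d * Φ x ≤ C * ∫ y in Metric.closedBall x₀ r, Ψ y) →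
      facetDiam F * facetInt F (fun x => g x * Φ x) ≤
        (C₁ + C₂) * (Cf * κ ^ (d - 1 + 1)) * R * 𝒯.cellInt T fun x => g x * Ψ x := by
    intro C Φ Ψ hC hCC hΦ0 hΨ0 hΨ hΦ
    refine mul_setIntegral_facet_le (m := d - 1) Metric.diam_nonneg hr hhr (by positivity) hCf.le
      hFT' hB hFn hTc.measurableSet (hf F hF'.2 hd (𝒯.indep hF'.1)) hmin hR
      (fun x hx => hgb x (hsub hx)) hΦ0 hΨ0 (SimplicialMesh.integrableOn_cell hΨ T)
      (SimplicialMesh.integrableOn_cell (hg.mul hΨ) T) fun x hx => ?_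
    rw [hd1]
    exact (hΦ x hx).trans (mul_le_mul_of_nonneg_right hCC (integral_nonneg hΨ0))
  refine ⟨fun b L hb => ?_, ?_⟩
  · refine key C₁ (fun x => ‖conv b v x‖ ^ 2) _ hC₁ (by linarith) (fun x => by positivity)
      (fun x => by positivity) ?_ (h₁ v hv x₀ r hr b L _ L.2 (hb.continuousOn.mono hsub) hB hTκ
        fun y hy => ?_)
    · exact ((hv.continuous_fderiv.continuousOn.clm_apply hb.continuousOn).norm.pow 2).add
        (continuousOn_const.mul (hv.continuous.norm.pow 2).continuousOn)
    · simpa [dist_eq_norm] using hb.dist_le_mul y (hsub hy) x₀ (hsub hx₀)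
  · have hk := hv.single_divg ⟨0, by omega⟩
    have hnorm : ∀ x, ‖EuclideanSpace.single (⟨0, by omega⟩ : Fin d) (divg v x)‖ = ‖divg v x‖ :=
      fun x => by simp
    have hc := hk.continuous.norm
    simp only [hnorm] at hc
    refine key C₂ (fun x => ‖divg v x‖ ^ 2) _ hC₂ (by linarith) (fun x => by positivity)
      (fun x => by positivity) (hc.pow 2).continuousOn fun x hx => ?_
    have := (h₂ _ hk x₀ r hr x (hTκ hx)).1
    simpa only [hnorm] using this

/-! ### Coercivity -/

section Coercivity

variable {𝒯 : SimplicialMesh d} {ρ cs : Vec d → ℝ} {b : Vec d → Vec d}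
  {u v : 𝒯.cells → Vec d → Vec d}

theorem inner_real_eq_mul (x y : ℝ) : ⟪x, y⟫_ℝ = x * y := by simp [mul_comm]

theorem continuousOn_conv (hb : ContinuousOn b 𝒯.closedDomain) {v : Vec d → Vec d}
    (hv : IsVecPoly p v) : ContinuousOn (conv b v) 𝒯.closedDomain :=
  hv.continuous_fderiv.continuousOn.clm_apply hb

theorem continuous_divg {v : Vec d → Vec d} (hv : IsVecPoly p v) : Continuous (divg v) := by
  have h := hv.continuous_fderiv
  unfold divg
  fun_prop

theorem continuousOn_bjump (hb : ContinuousOn b 𝒯.closedDomain) (hu : u ∈ dgSpace 𝒯 p)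
    (F : Finset (Vec d)) : ContinuousOn (bjump 𝒯 b F u) 𝒯.closedDomain :=
  continuousOn_finsetSum _ fun T _ =>
    (hb.inner (𝕜 := ℝ) continuousOn_const).smul (hu T).continuous.continuousOn

theorem continuous_njump (hu : u ∈ dgSpace 𝒯 p) (F : Finset (Vec d)) :
    Continuous (njump 𝒯 F u) :=
  continuous_finsetSum _ fun T _ => (hu T).continuous.inner (𝕜 := ℝ) continuous_const

theorem norm_sqrt_smul_sq {E : Type*} [NormedAddCommGroup E] [NormedSpace ℝ E] {a : ℝ}
    (ha : 0 ≤ a) (x : E) : ‖√a • x‖ ^ 2 = a * ‖x‖ ^ 2 := by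
  rw [norm_smul, mul_pow, Real.norm_of_nonneg (Real.sqrt_nonneg a), Real.sq_sqrt ha]

theorem cellInt_congr {f g : Vec d → ℝ} (h : ∀ x ∈ 𝒯.closedDomain, f x = g x) (T : 𝒯.cells) :
    𝒯.cellInt T f = 𝒯.cellInt T g :=
  setIntegral_congr_fun (isCompact_convexHull_finset _).measurableSet
    fun x hx => h x (SimplicialMesh.cell_subset T hx)

theorem facetInt_congr {f g : Vec d → ℝ} (h : ∀ x ∈ 𝒯.closedDomain, f x = g x)
    {F : Finset (Vec d)} (hF : F ∈ 𝒯.facets) : facetInt F f = facetInt F g :=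
  setIntegral_congr_fun (isCompact_convexHull_finset _).measurableSet
    fun x hx => h x (SimplicialMesh.facet_subset hF hx)

theorem cellInt_nonneg {f : Vec d → ℝ} (h : ∀ x ∈ 𝒯.closedDomain, 0 ≤ f x) (T : 𝒯.cells) :
    0 ≤ 𝒯.cellInt T f :=
  setIntegral_nonneg (isCompact_convexHull_finset _).measurableSet
    fun x hx => h x (SimplicialMesh.cell_subset T hx)

theorem convNormSq_nonneg : 0 ≤ convNormSq 𝒯 ρ b u :=
  Finset.sum_nonneg fun T _ => integral_nonneg fun x => by positivity

theorem l2NormSq_nonneg : 0 ≤ l2NormSq 𝒯 ρ u :=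
  Finset.sum_nonneg fun T _ => integral_nonneg fun x => by positivity

theorem bjumpNormSq_nonneg : 0 ≤ bjumpNormSq 𝒯 ρ b u :=
  Finset.sum_nonneg fun _ _ => integral_nonneg fun _ =>
    mul_nonneg (inv_nonneg.2 Metric.diam_nonneg) (sq_nonneg _)

theorem divNormSq_nonneg : 0 ≤ divNormSq 𝒯 ρ cs u :=
  Finset.sum_nonneg fun T _ => integral_nonneg fun x => by positivity

theorem njumpNormSq_nonneg : 0 ≤ njumpNormSq 𝒯 ρ cs u :=
  Finset.sum_nonneg fun _ _ => integral_nonneg fun _ =>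
    mul_nonneg (inv_nonneg.2 Metric.diam_nonneg) (sq_nonneg _)

/-- The parameter `ε` stays free: it must later be small relative to both the trace constant and the
ratio of `L²` to `‖b‖_∞²`. -/
theorem exists_aForm_self_ge (d p : ℕ) (hd : 2 ≤ d) (cT : ℝ) :
    ∃ M : ℝ, 0 < M ∧ ∀ 𝒯 : SimplicialMesh d, 𝒯.ShapeRegular cT →
      ∀ (ρ : Vec d → ℝ) (b : Vec d → Vec d) (ρmin ρmax R : ℝ) (L : ℝ≥0),
      ContinuousOn ρ 𝒯.closedDomain → 0 < ρmin →
      (∀ x ∈ 𝒯.closedDomain, ρmin ≤ ρ x ∧ ρ x ≤ ρmax) → 0 ≤ R → ρmax ≤ R * ρmin →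
      LipschitzOnWith L b 𝒯.closedDomain → ∀ (lam ε : ℝ), 0 < ε → ∀ u ∈ dgSpace 𝒯 p,
      convNormSq 𝒯 ρ b u + supNorm b 𝒯.domain ^ 2 * l2NormSq 𝒯 ρ u
        + (lam - ε⁻¹) * bjumpNormSq 𝒯 ρ b u
        - ε * (M * R) * (convNormSq 𝒯 ρ b u + (L : ℝ) ^ 2 * l2NormSq 𝒯 ρ u) ≤
      aForm 𝒯 ρ b lam u u := by
  obtain ⟨M, hM, h⟩ := exists_trace_le d p hd cT
  refine ⟨(d + 1) * M, by positivity, ?_⟩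
  intro 𝒯 hreg ρ b ρmin ρmax R L hρ hmin hρb hR0 hR hb lam ε hε u hu
  have hρ0 : ∀ x ∈ 𝒯.closedDomain, 0 ≤ ρ x := fun x hx => hmin.le.trans (hρb x hx).1
  have hconv : ∀ T, ContinuousOn (conv b (u T)) 𝒯.closedDomain := fun T =>
    continuousOn_conv hb.continuousOn (hu T)
  have hcu : ∀ T, ContinuousOn (u T) 𝒯.closedDomain := fun T => (hu T).continuous.continuousOn
  have hI1 : ∀ T : 𝒯.cells, IntegrableOn (fun x => ρ x * ‖conv b (u T) x‖ ^ 2)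
      (convexHull ℝ (T.1 : Set (Vec d))) := fun T =>
    SimplicialMesh.integrableOn_cell (hρ.mul ((hconv T).norm.pow 2)) T
  have hI2 : ∀ T : 𝒯.cells, IntegrableOn (fun x => ρ x * ‖u T x‖ ^ 2)
      (convexHull ℝ (T.1 : Set (Vec d))) := fun T =>
    SimplicialMesh.integrableOn_cell (hρ.mul ((hcu T).norm.pow 2)) T
  have hX : convNormSq 𝒯 ρ b u = ∑ T : 𝒯.cells, 𝒯.cellInt T fun x => ρ x * ‖conv b (u T) x‖ ^ 2 :=
    Finset.sum_congr rfl fun T _ => cellInt_congr (fun x hx => norm_sqrt_smul_sq (hρ0 x hx) _) T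
  have hY : l2NormSq 𝒯 ρ u = ∑ T : 𝒯.cells, 𝒯.cellInt T fun x => ρ x * ‖u T x‖ ^ 2 :=
    Finset.sum_congr rfl fun T _ => cellInt_congr (fun x hx => norm_sqrt_smul_sq (hρ0 x hx) _) T
  have hZ : bjumpNormSq 𝒯 ρ b u = ∑ F ∈ 𝒯.facets, facetInt F
      fun x => (facetDiam F)⁻¹ * (ρ x * ‖bjump 𝒯 b F u x‖ ^ 2) :=
    Finset.sum_congr rfl fun F hF => facetInt_congr
      (fun x hx => by rw [norm_sqrt_smul_sq (hρ0 x hx)]) hF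
  have hXY : ∀ a : ℝ, ∑ T : 𝒯.cells, (𝒯.cellInt T fun x =>
      ρ x * (‖conv b (u T) x‖ ^ 2 + a * ‖u T x‖ ^ 2)) =
      convNormSq 𝒯 ρ b u + a * l2NormSq 𝒯 ρ u := by
    intro a
    rw [hX, hY, Finset.mul_sum, ← Finset.sum_add_distrib]
    refine Finset.sum_congr rfl fun T _ => ?_
    unfold SimplicialMesh.cellInt
    rw [← integral_const_mul, ← integral_add (hI1 T) ((hI2 T).const_mul a)]
    congr with x
    ring
  have havg := sum_facetInt_avg_le (w := fun T => conv b (u T)) (M := M * R) hd (by positivity) hρ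
    hρ0 hconv
    (Ψ := fun T => 𝒯.cellInt T fun x => ρ x * (‖conv b (u T) x‖ ^ 2 + (L : ℝ) ^ 2 * ‖u T x‖ ^ 2))
    (fun T => cellInt_nonneg (fun x hx => mul_nonneg (hρ0 x hx) (by positivity)) T)
    (fun T F hF hFT => (h 𝒯 hreg ρ ρmin ρmax R hρ hmin hρb hR T F hF hFT _ (hu T)).1 b L hb)
  rw [hXY] at havg
  have hpen := sum_facetInt_penalty_ge (A := fun F => avg 𝒯 F fun T => conv b (u T))
    (J := fun F => bjump 𝒯 b F u) (lam := lam) hd hε hρ hρ0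
    (fun F => continuousOn_avg F hconv) (fun F => continuousOn_bjump hb.continuousOn hu F)
  rw [← hZ] at hpen
  have hcell := hXY (supNorm b 𝒯.domain ^ 2)
  unfold aForm
  simp only [real_inner_self_eq_norm_sq] at hpen ⊢
  rw [hcell]
  have := mul_le_mul_of_nonneg_left havg hε.le
  linarith

/-- The divergence is itself polynomial, so the trace inequality has no lower-order remainder and no
zeroth-order term is needed to absorb one. The weight is `ρ c_s²`. -/
theorem exists_bForm_self_ge (d p : ℕ) (hd : 2 ≤ d) (cT : ℝ) :
    ∃ M : ℝ, 0 < M ∧ ∀ 𝒯 : SimplicialMesh d, 𝒯.ShapeRegular cT →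
      ∀ (ρ cs : Vec d → ℝ) (gmin gmax R : ℝ),
      ContinuousOn ρ 𝒯.closedDomain → ContinuousOn cs 𝒯.closedDomain → 0 < gmin →
      (∀ x ∈ 𝒯.closedDomain, 0 ≤ ρ x) →
      (∀ x ∈ 𝒯.closedDomain, gmin ≤ ρ x * cs x ^ 2 ∧ ρ x * cs x ^ 2 ≤ gmax) → 0 ≤ R →
      gmax ≤ R * gmin → ∀ (lam ε : ℝ), 0 < ε → ∀ u ∈ dgSpace 𝒯 p,
      divNormSq 𝒯 ρ cs u + (lam - ε⁻¹) * njumpNormSq 𝒯 ρ cs u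
        - ε * (M * R) * divNormSq 𝒯 ρ cs u ≤ bForm 𝒯 ρ cs lam u u := by
  obtain ⟨M, hM, h⟩ := exists_trace_le d p hd cT
  refine ⟨(d + 1) * M, by positivity, ?_⟩
  intro 𝒯 hreg ρ cs gmin gmax R hρ hcs hmin hρ0 hgb hR0 hR lam ε hε u hu
  have hg : ContinuousOn (fun x => ρ x * cs x ^ 2) 𝒯.closedDomain := hρ.mul (hcs.pow 2)
  have hg0 : ∀ x ∈ 𝒯.closedDomain, 0 ≤ ρ x * cs x ^ 2 := fun x hx => hmin.le.trans (hgb x hx).1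
  have hdiv : ∀ T, ContinuousOn (divg (u T)) 𝒯.closedDomain := fun T =>
    (continuous_divg (hu T)).continuousOn
  have hsq : ∀ x ∈ 𝒯.closedDomain, ∀ t : ℝ,
      (cs x * √(ρ x) * t) ^ 2 = ρ x * cs x ^ 2 * ‖t‖ ^ 2 := fun x hx t => by
    rw [mul_pow, mul_pow, Real.sq_sqrt (hρ0 x hx), Real.norm_eq_abs, sq_abs, mul_comm (ρ x)]
  have hX : divNormSq 𝒯 ρ cs u =
      ∑ T : 𝒯.cells, 𝒯.cellInt T fun x => ρ x * cs x ^ 2 * ‖divg (u T) x‖ ^ 2 :=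
    Finset.sum_congr rfl fun T _ => cellInt_congr (fun x hx => hsq x hx _) T
  have hZ : njumpNormSq 𝒯 ρ cs u = ∑ F ∈ 𝒯.facets, facetInt F
      fun x => (facetDiam F)⁻¹ * (ρ x * cs x ^ 2 * ‖njump 𝒯 F u x‖ ^ 2) :=
    Finset.sum_congr rfl fun F hF => facetInt_congr (fun x hx => by rw [hsq x hx]) hF
  have havg := sum_facetInt_avg_le (w := fun T => divg (u T)) (M := M * R) hd (by positivity) hg
    hg0 hdiv (Ψ := fun T => 𝒯.cellInt T fun x => ρ x * cs x ^ 2 * ‖divg (u T) x‖ ^ 2)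
    (fun T => cellInt_nonneg (fun x hx => mul_nonneg (hg0 x hx) (by positivity)) T)
    (fun T F hF hFT => (h 𝒯 hreg _ gmin gmax R hg hmin hgb hR T F hF hFT _ (hu T)).2)
  rw [← hX] at havg
  have hpen := sum_facetInt_penalty_ge (A := fun F => avg 𝒯 F fun T => divg (u T))
    (J := fun F => njump 𝒯 F u) (lam := lam) hd hε hg hg0
    (fun F => continuousOn_avg F hdiv) (fun F => (continuous_njump hu F).continuousOn)
  rw [← hZ] at hpen
  unfold bForm
  simp only [inner_real_eq_mul] at hpen
  simp only [Real.norm_eq_abs, sq_abs, sq (divg _ _)] at hX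
  rw [← hX]
  have := mul_le_mul_of_nonneg_left havg hε.le
  linarith

end Coercivity

/-! ### The norm induced by the forms -/

section Norm

variable {𝒯 : SimplicialMesh d} {ρ cs : Vec d → ℝ} {b : Vec d → Vec d}

theorem aForm_comm (lam : ℝ) (u v : 𝒯.cells → Vec d → Vec d) :
    aForm 𝒯 ρ b lam u v = aForm 𝒯 ρ b lam v u := by
  unfold aForm
  simp only [real_inner_comm (conv b (v _) _), real_inner_comm (v _ _),
    real_inner_comm (bjump 𝒯 b _ v _) (bjump 𝒯 b _ u _)]
  ring

theorem bForm_comm (lam : ℝ) (u v : 𝒯.cells → Vec d → Vec d) :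
    bForm 𝒯 ρ cs lam u v = bForm 𝒯 ρ cs lam v u := by
  unfold bForm
  simp only [mul_comm (divg (v _) _) (divg (u _) _), mul_comm (njump 𝒯 _ v _) (njump 𝒯 _ u _)]
  ring

/-- Evaluation of the piece of `u` on an element. -/
def pieceMap (𝒯 : SimplicialMesh d) (p : ℕ) (T : 𝒯.cells) : dgSpace 𝒯 p →ₗ[ℝ] (Vec d → Vec d) where
  toFun u := u.1 T
  map_add' _ _ := rfl
  map_smul' _ _ := rfl

/-- The streamline derivative of the piece of `u` on an element. -/
def convMap (p : ℕ) (b : Vec d → Vec d) (T : 𝒯.cells) : dgSpace 𝒯 p →ₗ[ℝ] (Vec d → Vec d) where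
  toFun u := conv b (u.1 T)
  map_add' u v := by
    ext1 x
    simp [conv, fderiv_add ((u.2 T).differentiable x) ((v.2 T).differentiable x)]
  map_smul' c u := by
    ext1 x
    simp [conv, fderiv_const_smul ((u.2 T).differentiable x)]

/-- The divergence of the piece of `u` on an element. -/
def divMap (𝒯 : SimplicialMesh d) (p : ℕ) (T : 𝒯.cells) : dgSpace 𝒯 p →ₗ[ℝ] (Vec d → ℝ) where
  toFun u := divg (u.1 T)
  map_add' u v := by
    ext1 x
    simp [divg, fderiv_add ((u.2 T).differentiable x) ((v.2 T).differentiable x),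
      Finset.sum_add_distrib]
  map_smul' c u := by
    ext1 x
    simp [divg, fderiv_const_smul ((u.2 T).differentiable x), Finset.mul_sum]

/-- The average on a facet as a linear map. -/
def avgMap {V E : Type*} [AddCommGroup V] [Module ℝ V] [AddCommGroup E] [Module ℝ E]
    (F : Finset (Vec d)) (w : 𝒯.cells → V →ₗ[ℝ] (Vec d → E)) : V →ₗ[ℝ] (Vec d → E) :=
  ((𝒯.adj F).card : ℝ)⁻¹ • ∑ T ∈ 𝒯.adj F, w T

theorem avgMap_apply {V E : Type*} [AddCommGroup V] [Module ℝ V] [AddCommGroup E] [Module ℝ E]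
    (F : Finset (Vec d)) (w : 𝒯.cells → V →ₗ[ℝ] (Vec d → E)) (u : V) :
    avgMap F w u = avg 𝒯 F fun T => w T u := by
  ext1 x
  simp [avgMap, avg]

/-- The jump weighted with the normal velocity as a linear map. -/
def bjumpMap (p : ℕ) (b : Vec d → Vec d) (F : Finset (Vec d)) :
    dgSpace 𝒯 p →ₗ[ℝ] (Vec d → Vec d) where
  toFun u := bjump 𝒯 b F u.1
  map_add' u v := by
    ext1 x
    simp [bjump, Finset.sum_add_distrib]
  map_smul' c u := by
    ext1 x
    simp [bjump, Finset.smul_sum, smul_comm c]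

/-- The normal jump as a linear map. -/
def njumpMap (𝒯 : SimplicialMesh d) (p : ℕ) (F : Finset (Vec d)) :
    dgSpace 𝒯 p →ₗ[ℝ] (Vec d → ℝ) where
  toFun u := njump 𝒯 F u.1
  map_add' u v := by
    ext1 x
    simp [njump, Finset.sum_add_distrib, inner_add_left]
  map_smul' c u := by
    ext1 x
    simp [njump, Finset.mul_sum, real_inner_smul_left]

theorem isBilin_cellInt {V E : Type*} [AddCommGroup V] [Module ℝ V] [NormedAddCommGroup E]
    [InnerProductSpace ℝ E] {g : Vec d → ℝ} (hg : ContinuousOn g 𝒯.closedDomain) (T : 𝒯.cells)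
    {P : V →ₗ[ℝ] (Vec d → E)} (hP : ∀ u, ContinuousOn (P u) 𝒯.closedDomain) :
    IsBilin fun u v => 𝒯.cellInt T fun x => g x * ⟪P u x, P v x⟫_ℝ :=
  isBilin_setIntegral g P P fun u v =>
    SimplicialMesh.integrableOn_cell (hg.mul ((hP u).inner (𝕜 := ℝ) (hP v))) T

theorem isBilin_facetInt (hd : 2 ≤ d) {V E : Type*} [AddCommGroup V] [Module ℝ V]
    [NormedAddCommGroup E] [InnerProductSpace ℝ E] {g : Vec d → ℝ}
    (hg : ContinuousOn g 𝒯.closedDomain) {F : Finset (Vec d)} (hF : F ∈ 𝒯.facets)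
    {P Q : V →ₗ[ℝ] (Vec d → E)} (hP : ∀ u, ContinuousOn (P u) 𝒯.closedDomain)
    (hQ : ∀ u, ContinuousOn (Q u) 𝒯.closedDomain) :
    IsBilin fun u v => facetInt F fun x => g x * ⟪P u x, Q v x⟫_ℝ :=
  isBilin_setIntegral g P Q fun u v =>
    SimplicialMesh.integrableOn_facet hd (hg.mul ((hP u).inner (𝕜 := ℝ) (hQ v))) hF

theorem isBilin_aForm (hd : 2 ≤ d) (hρ : ContinuousOn ρ 𝒯.closedDomain)
    (hb : ContinuousOn b 𝒯.closedDomain) (lam : ℝ) :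
    IsBilin fun u v : dgSpace 𝒯 p => aForm 𝒯 ρ b lam u.1 v.1 := by
  have hconv : ∀ (T : 𝒯.cells) (u : dgSpace 𝒯 p), ContinuousOn (convMap p b T u) 𝒯.closedDomain :=
    fun T u => continuousOn_conv hb (u.2 T)
  have hpiece : ∀ (T : 𝒯.cells) (u : dgSpace 𝒯 p),
      ContinuousOn (pieceMap 𝒯 p T u) 𝒯.closedDomain := fun T u => (u.2 T).continuous.continuousOn
  have hjump : ∀ F (u : dgSpace 𝒯 p), ContinuousOn (bjumpMap p b F u) 𝒯.closedDomain :=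
    fun F u => continuousOn_bjump hb u.2 F
  have havg : ∀ F (u : dgSpace 𝒯 p), ContinuousOn (avgMap F (convMap p b) u) 𝒯.closedDomain :=
    fun F u => by
      rw [avgMap_apply]
      exact continuousOn_avg F fun T => hconv T u
  have h3 : IsBilin fun u v : dgSpace 𝒯 p => ∑ F ∈ 𝒯.facets, facetInt F fun x =>
      ρ x * ⟪avg 𝒯 F (fun T => conv b (u.1 T)) x, bjump 𝒯 b F v.1 x⟫_ℝ :=
    IsBilin.sum fun F hF => by
      have := isBilin_facetInt hd hρ hF (havg F) (hjump F)
      simp only [avgMap_apply] at this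
      exact this
  have h1 : IsBilin fun u v : dgSpace 𝒯 p => ∑ T : 𝒯.cells, 𝒯.cellInt T fun x =>
      ρ x * (⟪conv b (u.1 T) x, conv b (v.1 T) x⟫_ℝ
        + supNorm b 𝒯.domain ^ 2 * ⟪u.1 T x, v.1 T x⟫_ℝ) :=
    IsBilin.sum fun T _ => by
      have hρ' : ContinuousOn (fun x => ρ x * supNorm b 𝒯.domain ^ 2) 𝒯.closedDomain :=
        hρ.mul continuousOn_const
      refine ((isBilin_cellInt hρ T (hconv T)).add (isBilin_cellInt hρ' T (hpiece T))).congr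
        fun u v => ?_
      unfold SimplicialMesh.cellInt
      refine (integral_add
        (SimplicialMesh.integrableOn_cell (hρ.mul ((hconv T u).inner (𝕜 := ℝ) (hconv T v))) T)
        (SimplicialMesh.integrableOn_cell (hρ'.mul ((hpiece T u).inner (𝕜 := ℝ) (hpiece T v))) T)).symm.trans ?_
      congr with x
      simp only [convMap, pieceMap, LinearMap.coe_mk, AddHom.coe_mk, Pi.mul_apply]
      ring
  have h2 : IsBilin fun u v : dgSpace 𝒯 p => ∑ F ∈ 𝒯.facets, facetInt F fun x =>
      ρ x * (lam / facetDiam F) * ⟪bjump 𝒯 b F u.1 x, bjump 𝒯 b F v.1 x⟫_ℝ :=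
    IsBilin.sum fun F hF => by
      have := isBilin_facetInt hd (hρ.mul (continuousOn_const (c := lam / facetDiam F))) hF
        (hjump F) (hjump F)
      exact this
  -- The last consistency sum is the third one with its arguments exchanged.
  exact ((h1.add h2).sub h3).sub h3.flip

theorem isBilin_bForm (hd : 2 ≤ d) (hρ : ContinuousOn ρ 𝒯.closedDomain)
    (hcs : ContinuousOn cs 𝒯.closedDomain) (lam : ℝ) :
    IsBilin fun u v : dgSpace 𝒯 p => bForm 𝒯 ρ cs lam u.1 v.1 := by
  have hg : ContinuousOn (fun x => ρ x * cs x ^ 2) 𝒯.closedDomain := hρ.mul (hcs.pow 2)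
  have hdiv : ∀ (T : 𝒯.cells) (u : dgSpace 𝒯 p), ContinuousOn (divMap 𝒯 p T u) 𝒯.closedDomain :=
    fun T u => (continuous_divg (u.2 T)).continuousOn
  have hjump : ∀ F (u : dgSpace 𝒯 p), ContinuousOn (njumpMap 𝒯 p F u) 𝒯.closedDomain :=
    fun F u => (continuous_njump u.2 F).continuousOn
  have havg : ∀ F (u : dgSpace 𝒯 p), ContinuousOn (avgMap F (divMap 𝒯 p) u) 𝒯.closedDomain :=
    fun F u => by
      rw [avgMap_apply]
      exact continuousOn_avg F fun T => hdiv T u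
  have h1 : IsBilin fun u v : dgSpace 𝒯 p => ∑ T : 𝒯.cells, 𝒯.cellInt T fun x =>
      ρ x * cs x ^ 2 * (divg (u.1 T) x * divg (v.1 T) x) :=
    IsBilin.sum fun T _ => by
      have := isBilin_cellInt hg T (hdiv T)
      simp only [inner_real_eq_mul] at this
      exact this
  have h2 : IsBilin fun u v : dgSpace 𝒯 p => ∑ F ∈ 𝒯.facets, facetInt F fun x =>
      ρ x * cs x ^ 2 * (lam / facetDiam F) * (njump 𝒯 F u.1 x * njump 𝒯 F v.1 x) :=
    IsBilin.sum fun F hF => by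
      have := isBilin_facetInt hd (hg.mul (continuousOn_const (c := lam / facetDiam F))) hF
        (hjump F) (hjump F)
      simp only [inner_real_eq_mul] at this
      exact this
  have h3 : IsBilin fun u v : dgSpace 𝒯 p => ∑ F ∈ 𝒯.facets, facetInt F fun x =>
      ρ x * cs x ^ 2 * (avg 𝒯 F (fun T => divg (u.1 T)) x * njump 𝒯 F v.1 x) :=
    IsBilin.sum fun F hF => by
      have := isBilin_facetInt hd hg hF (havg F) (hjump F)
      simp only [avgMap_apply, inner_real_eq_mul] at this
      exact this
  exact ((h1.add h2).sub h3).sub h3.flip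

/-- Elements of `dgSpace` are polynomials on all of space, so vanishing is needed also outside the
element. -/
theorem eq_zero_of_l2NormSq_eq_zero (hd : 2 ≤ d) {cT : ℝ} (hreg : 𝒯.ShapeRegular cT) {ρmin : ℝ}
    (hρ : ContinuousOn ρ 𝒯.closedDomain) (hmin : 0 < ρmin) (hρb : ∀ x ∈ 𝒯.closedDomain, ρmin ≤ ρ x)
    {u : 𝒯.cells → Vec d → Vec d} (hu : u ∈ dgSpace 𝒯 p) (h : l2NormSq 𝒯 ρ u = 0) : u = 0 := by
  ext1 T
  have hT := SimplicialMesh.mem_cells.1 T.2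
  obtain ⟨x₀, r, hr, hB, -⟩ := exists_ball_subset_cell hd hT.2 (𝒯.indep hT.1) (hreg T.1 T.2)
  have hc := (hu T).continuous.norm.pow 2
  have h0 : 𝒯.cellInt T (fun x => ‖√(ρ x) • u T x‖ ^ 2) = 0 :=
    (Finset.sum_eq_zero_iff_of_nonneg fun T _ => integral_nonneg fun x => by positivity).1 h T
      (Finset.mem_univ T)
  rw [cellInt_congr (fun x hx => norm_sqrt_smul_sq (hmin.le.trans (hρb x hx)) _)] at h0
  have hle : ρmin * ∫ x in convexHull ℝ (T.1 : Set (Vec d)), ‖u T x‖ ^ 2 ≤ 0 := by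
    rw [← integral_const_mul, ← h0]
    exact setIntegral_mono_on ((SimplicialMesh.integrableOn_cell hc.continuousOn T).const_mul _)
      (SimplicialMesh.integrableOn_cell (hρ.mul hc.continuousOn) T)
      (isCompact_convexHull_finset _).measurableSet fun x hx =>
        mul_le_mul_of_nonneg_right (hρb x (SimplicialMesh.cell_subset T hx)) (by positivity)
  have hball : ∫ x in Metric.closedBall x₀ r, ‖u T x‖ ^ 2 ≤ 0 :=
    (setIntegral_mono_set (SimplicialMesh.integrableOn_cell hc.continuousOn T)
      (.of_forall fun _ => sq_nonneg _) (.of_forall hB)).trans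
      (nonpos_of_mul_nonpos_right hle hmin)
  ext1 x
  -- This choice of `κ` makes the larger ball reach `x`; the constant may depend on `x`, as the
  -- integral is zero.
  obtain ⟨C, hC, hCx⟩ := exists_sq_le_integral_ball d p (dist x x₀ / r)
  have h1 := (hCx (u T) (hu T) x₀ r hr x (by
    rw [div_mul_cancel₀ _ hr.ne']; exact Metric.mem_closedBall.2 le_rfl)).1
  have h2 : r ^ d * ‖u T x‖ ^ 2 ≤ 0 := h1.trans (mul_nonpos_of_nonneg_of_nonpos hC.le hball)
  have h3 : ‖u T x‖ ^ 2 ≤ 0 := nonpos_of_mul_nonpos_right h2 (by positivity)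
  simpa using le_antisymm h3 (sq_nonneg _)

end Norm

end GalbrunDG

end

/-! ### Choice of the constants and proof of the theorem. -/

theorem mainTheorem4 (d p : ℕ) (hd : 2 ≤ d) (cT Rρ : ℝ) :
    ∃ (c₁ Λb : ℝ≥0 → ℝ → ℝ) (c₂ Λn : ℝ → ℝ),
      (∀ (L : ℝ≥0) (β : ℝ), 0 < β → 0 < c₁ L β ∧ 0 < Λb L β) ∧
      (∀ Rc : ℝ, 0 < c₂ Rc ∧ 0 < Λn Rc) ∧
      ∀ (𝒯 : GalbrunDG.SimplicialMesh d) (_ : 𝒯.ShapeRegular cT)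
        (ρ cs : GalbrunDG.Vec d → ℝ) (b : GalbrunDG.Vec d → GalbrunDG.Vec d)
        (ρmin ρmax cmin cmax Rc β : ℝ) (L : ℝ≥0)
        (_ : ContinuousOn ρ 𝒯.closedDomain) (_ : ContinuousOn cs 𝒯.closedDomain)
        (_ : 0 < ρmin) (_ : ∀ x ∈ 𝒯.closedDomain, ρmin ≤ ρ x ∧ ρ x ≤ ρmax)
        (_ : ρmax / ρmin ≤ Rρ)
        (_ : 0 < cmin) (_ : ∀ x ∈ 𝒯.closedDomain, cmin ≤ cs x ∧ cs x ≤ cmax)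
        (_ : cmax / cmin ≤ Rc)
        (_ : LipschitzOnWith L b 𝒯.closedDomain)
        (_ : 𝒯.TangentialOnBoundary b)
        (_ : GalbrunDG.supNorm b 𝒯.domain = β) (_ : 0 < β)
        (lamb lamn : ℝ) (_ : Λb L β ≤ lamb) (_ : Λn Rc ≤ lamn),
        (∀ u ∈ GalbrunDG.dgSpace 𝒯 p,
          c₁ L β * (GalbrunDG.convNormSq 𝒯 ρ b u + GalbrunDG.l2NormSq 𝒯 ρ u
              + GalbrunDG.bjumpNormSq 𝒯 ρ b u)
            ≤ GalbrunDG.aForm 𝒯 ρ b lamb u u) ∧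
        (∀ u ∈ GalbrunDG.dgSpace 𝒯 p,
          c₂ Rc * (GalbrunDG.divNormSq 𝒯 ρ cs u + GalbrunDG.njumpNormSq 𝒯 ρ cs u)
            ≤ GalbrunDG.bForm 𝒯 ρ cs lamn u u) ∧
        ∃ N : Seminorm ℝ (GalbrunDG.dgSpace 𝒯 p),
          (∀ u : GalbrunDG.dgSpace 𝒯 p,
            N u ^ 2 = GalbrunDG.aForm 𝒯 ρ b lamb u.1 u.1
              + GalbrunDG.bForm 𝒯 ρ cs lamn u.1 u.1) ∧
          ∀ u : GalbrunDG.dgSpace 𝒯 p, N u = 0 → u = 0 := by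
  obtain ⟨Ma, hMa, ha⟩ := GalbrunDG.exists_aForm_self_ge d p hd cT
  obtain ⟨Mb, hMb, hb⟩ := GalbrunDG.exists_bForm_self_ge d p hd cT
  set R := max Rρ 1
  have hR1 : 1 ≤ R := le_max_right _ _
  have hR0 : 0 < R := by linarith
  -- With `q = 1 + L² / β²` and `ε = (2 M R q)⁻¹`, half of each volume term survives. The thresholds
  -- are `ε⁻¹ + 1/2`, so that the jump coefficient `λ - ε⁻¹` is at least `1/2`. For `b_h` the role
  -- of `R` is played by `R * max Rc 1 ^ 2` and `q` is absent.
  refine ⟨fun _ β => min (1 / 2) (β ^ 2 / 2),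
    fun L β => 2 * (Ma * R) * (1 + (L : ℝ) ^ 2 / β ^ 2) + 1 / 2, fun _ => 1 / 2,
    fun Rc => 2 * (Mb * (R * max Rc 1 ^ 2)) + 1 / 2, fun L β hβ => ⟨by positivity, by positivity⟩,
    fun Rc => ⟨by norm_num, by positivity⟩, ?_⟩
  intro 𝒯 hreg ρ cs b ρmin ρmax cmin cmax Rc β L hρ hcs hρmin hρb hRρ hcmin hcb hRc hbL _ hβ hβ0
    lamb lamn hlamb hlamn
  have hR' : ρmax ≤ R * ρmin := (div_le_iff₀ hρmin).1 (hRρ.trans (le_max_left _ _))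
  have hRc' : cmax ≤ max Rc 1 * cmin := (div_le_iff₀ hcmin).1 (hRc.trans (le_max_left _ _))
  have hρ0 : ∀ x ∈ 𝒯.closedDomain, 0 ≤ ρ x := fun x hx => hρmin.le.trans (hρb x hx).1
  have hA : ∀ u ∈ GalbrunDG.dgSpace 𝒯 p,
      min (1 / 2) (β ^ 2 / 2) * (GalbrunDG.convNormSq 𝒯 ρ b u + GalbrunDG.l2NormSq 𝒯 ρ u
        + GalbrunDG.bjumpNormSq 𝒯 ρ b u) ≤ GalbrunDG.aForm 𝒯 ρ b lamb u u := by
    intro u hu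
    set q : ℝ := 1 + (L : ℝ) ^ 2 / β ^ 2 with hq
    have hq0 : 0 < q := by positivity
    have h := ha 𝒯 hreg ρ b ρmin ρmax R L hρ hρmin hρb hR0.le hR' hbL lamb
      (2 * (Ma * R) * q)⁻¹ (by positivity) u hu
    have hX : 0 ≤ GalbrunDG.convNormSq 𝒯 ρ b u := GalbrunDG.convNormSq_nonneg
    have hY : 0 ≤ GalbrunDG.l2NormSq 𝒯 ρ u := GalbrunDG.l2NormSq_nonneg
    have hZ : 0 ≤ GalbrunDG.bjumpNormSq 𝒯 ρ b u := GalbrunDG.bjumpNormSq_nonneg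
    have e1 : (2 * (Ma * R) * q)⁻¹ * (Ma * R) = 1 / (2 * q) := by field_simp
    have e2 : 1 / (2 * q) ≤ 1 / 2 := by
      have : 1 ≤ q := le_add_of_nonneg_right (by positivity)
      exact one_div_le_one_div_of_le two_pos (by linarith)
    -- Since `β² q = β² + L²`, the freezing error uses at most half of `β² ‖√ρ u‖²`.
    have e3 : 1 / (2 * q) * (L : ℝ) ^ 2 ≤ β ^ 2 / 2 := by
      rw [one_div_mul_eq_div, div_le_iff₀ (by positivity)]
      have : β ^ 2 * q = β ^ 2 + (L : ℝ) ^ 2 := by rw [hq]; field_simp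
      nlinarith [sq_nonneg β]
    rw [e1, inv_inv, hβ] at h
    have m1 : min (1 / 2) (β ^ 2 / 2) ≤ 1 / 2 := min_le_left _ _
    have m2 : min (1 / 2) (β ^ 2 / 2) ≤ β ^ 2 / 2 := min_le_right _ _
    have i1 := mul_le_mul_of_nonneg_right m1 hX
    have i2 := mul_le_mul_of_nonneg_right m2 hY
    have i3 := mul_le_mul_of_nonneg_right (m1.trans (by linarith :
      (1 : ℝ) / 2 ≤ lamb - 2 * (Ma * R) * q)) hZ
    have i4 := mul_le_mul_of_nonneg_right e2 hX
    have i5 := mul_le_mul_of_nonneg_right e3 hY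
    linarith
  have hB : ∀ u ∈ GalbrunDG.dgSpace 𝒯 p,
      1 / 2 * (GalbrunDG.divNormSq 𝒯 ρ cs u + GalbrunDG.njumpNormSq 𝒯 ρ cs u)
        ≤ GalbrunDG.bForm 𝒯 ρ cs lamn u u := by
    intro u hu
    have hg : ∀ x ∈ 𝒯.closedDomain, ρmin * cmin ^ 2 ≤ ρ x * cs x ^ 2 ∧
        ρ x * cs x ^ 2 ≤ R * max Rc 1 ^ 2 * (ρmin * cmin ^ 2) := fun x hx => by
      obtain ⟨h1, h2⟩ := hρb x hx
      obtain ⟨h3, h4⟩ := hcb x hx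
      have hc0 : 0 ≤ cs x := hcmin.le.trans h3
      refine ⟨mul_le_mul h1 (pow_le_pow_left₀ hcmin.le h3 2) (by positivity) (hρ0 x hx), ?_⟩
      calc ρ x * cs x ^ 2 ≤ R * ρmin * (max Rc 1 * cmin) ^ 2 :=
            mul_le_mul (h2.trans hR') (pow_le_pow_left₀ hc0 (h4.trans hRc') 2) (by positivity)
              (by positivity)
        _ = _ := by ring
    have h := hb 𝒯 hreg ρ cs _ _ _ hρ hcs (mul_pos hρmin (pow_pos hcmin 2)) hρ0 hg (by positivity)
      le_rfl lamn (2 * (Mb * (R * max Rc 1 ^ 2)))⁻¹ (by positivity) u hu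
    have hZ : 0 ≤ GalbrunDG.njumpNormSq 𝒯 ρ cs u := GalbrunDG.njumpNormSq_nonneg
    have e1 : (2 * (Mb * (R * max Rc 1 ^ 2)))⁻¹ * (Mb * (R * max Rc 1 ^ 2)) = 1 / 2 := by
      field_simp
    rw [e1, inv_inv] at h
    have i3 := mul_le_mul_of_nonneg_right (by linarith :
      (1 : ℝ) / 2 ≤ lamn - 2 * (Mb * (R * max Rc 1 ^ 2))) hZ
    linarith
  refine ⟨hA, hB, ?_⟩
  have hc₁ : 0 < min (1 / 2) (β ^ 2 / 2) := by positivity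
  have hB0 : ∀ u ∈ GalbrunDG.dgSpace 𝒯 p, 0 ≤ GalbrunDG.bForm 𝒯 ρ cs lamn u u := fun u hu =>
    (mul_nonneg (by norm_num) (add_nonneg GalbrunDG.divNormSq_nonneg
      GalbrunDG.njumpNormSq_nonneg)).trans (hB u hu)
  have hA0 : ∀ u ∈ GalbrunDG.dgSpace 𝒯 p, 0 ≤ GalbrunDG.aForm 𝒯 ρ b lamb u u := fun u hu =>
    (mul_nonneg hc₁.le (add_nonneg (add_nonneg GalbrunDG.convNormSq_nonneg
      GalbrunDG.l2NormSq_nonneg) GalbrunDG.bjumpNormSq_nonneg)).trans (hA u hu)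
  obtain ⟨N, hN⟩ := ((GalbrunDG.isBilin_aForm (p := p) hd hρ hbL.continuousOn lamb).add
    (GalbrunDG.isBilin_bForm hd hρ hcs lamn)).exists_seminorm
    (fun u v => by rw [GalbrunDG.aForm_comm, GalbrunDG.bForm_comm])
    (fun u => add_nonneg (hA0 u.1 u.2) (hB0 u.1 u.2))
  refine ⟨N, hN, fun u hu => ?_⟩
  have h0 := hN u
  rw [hu, zero_pow two_ne_zero] at h0
  have h1 : GalbrunDG.aForm 𝒯 ρ b lamb u.1 u.1 ≤ 0 := by linarith [hB0 u.1 u.2]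
  have hX : 0 ≤ GalbrunDG.convNormSq 𝒯 ρ b u.1 := GalbrunDG.convNormSq_nonneg
  have hY : 0 ≤ GalbrunDG.l2NormSq 𝒯 ρ u.1 := GalbrunDG.l2NormSq_nonneg
  have hZ : 0 ≤ GalbrunDG.bjumpNormSq 𝒯 ρ b u.1 := GalbrunDG.bjumpNormSq_nonneg
  have h2 := nonpos_of_mul_nonpos_right ((hA u.1 u.2).trans h1) hc₁
  exact Subtype.ext (GalbrunDG.eq_zero_of_l2NormSq_eq_zero hd hreg hρ hρmin
    (fun x hx => (hρb x hx).1) u.2 (by linarith))
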